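/- Let $K$ be a field, let $E=K\langle e_1,\dots,e_n\rangle$ be the exterior algebra of a $K$-vector space with basis $e_1,\dots,e_n$, and for $\mu=\{i_1<\dots<i_d\}\subseteq[n]$ let $e_\mu=e_{i_1}\wedge\dots\wedge e_{i_d}$ be the monomial of degree $d$ ($e_\emptyset=1$). Let $I\subset E$ be a monomial ideal (an ideal generated by monomials), let $G(I)$ be its unique minimal set of monomial generators, and let $G(I)_j$ be the set of those of degree $j$. Assume that $I$ has linear quotients with respect to an order $u_1,\dots,u_r$ of $G(I)$ with $\deg u_1\le\dots\le\deg u_r$: each of the ideals $0:(u_1)$ and $(u_1,\dots,u_{k-1}):(u_k)$, $2\le k\le r$, is generated by a subset of $\{e_1,\dots,e_n\}$. Put $\mathrm{set}(u_k)=\{l\in[n] : e_l\in(u_1,\dots,u_{k-1}):(u_k)\}$, where for $k=1$ the ideal is $0:(u_1)$. Let $\beta_{i,j}(I)=\dim_K\mathrm{Tor}_i^E(I,K)_j$ be the graded Betti numbers of $I$ and let $P_I(s,t)=\sum_{i,j\ge0}\beta_{i,j}(I)\,t^is^j\in\mathbb Z[[s,t]]$ be its graded Poincaré series over $E$. Then,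 as formal power series, $$P_I(s,t)=\sum_{i\ge0}\ \sum_{j\ge0}\ \sum_{u\in G(I)_j}\binom{i+|\mathrm{set}(u)|-1}{i}\,t^i\,s^{i+j}.$$ (For $\mathrm{set}(u)=\emptyset$, which happens only for $u=1$, the binomial coefficient is read as $1$ if $i=0$ and as $0$ if $i>0$.) -/

import Mathlib

open scoped TensorProduct MvPowerSeries.WithPiTopology

noncomputable section

namespace ExtLinQuot

universe u

/-- The exterior algebra `E = K⟨e_1, …, e_n⟩` of the vector space `V = Kⁿ` with its standard
basis; the variables are indexed by `Fin n`. -/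
abbrev ExtAlg (K : Type u) [Field K] (n : ℕ) : Type u := ExteriorAlgebra K (Fin n → K)

section Monomials

variable (K : Type u) [Field K] {n : ℕ}

/-- The monomial `e_μ = e_{i_1} ∧ ⋯ ∧ e_{i_d}` for `μ = {i_1 < ⋯ < i_d}` (with `e_∅ = 1`).
Its degree is `μ.card` and its support is `μ`. -/
def mono (μ : Finset (Fin n)) : ExtAlg K n := (Pi.basisFun K (Fin n)).ExteriorAlgebra μ

/-- The variable `e_k`. -/
def var (k : Fin n) : ExtAlg K n := ExteriorAlgebra.ι K (Pi.single k 1)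

/-- The ideal generated by the monomials `e_μ`, `μ ∈ S`. `Ideal` is Mathlib's left ideal; since
monomials commute with each other up to sign, a left ideal that is generated by monomials is
two-sided. -/
def monoIdeal (S : Set (Finset (Fin n))) : Ideal (ExtAlg K n) := Ideal.span (mono K '' S)

end Monomials

section LinearQuotients

variable {K : Type u} [Field K] {n : ℕ}

/-- A monomial ideal: an ideal that is generated by monomials. -/
def IsMonomialIdeal (I : Ideal (ExtAlg K n)) : Prop :=
  ∃ S : Set (Finset (Fin n)), I = monoIdeal K S

/-- The minimal set `G(I)` of monomial generators of a monomial ideal `I`: the monomials of `I`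
that are minimal for divisibility, where `e_ν` divides `e_μ` exactly when `ν ⊆ μ`. A monomial is
recorded by its support. -/
def minGens (I : Ideal (ExtAlg K n)) : Set (Finset (Fin n)) :=
  {μ | mono K μ ∈ I ∧ ∀ ν, ν ⊂ μ → mono K ν ∉ I}

/-- The colon ideal `(u_1, …, u_{j-1}) : (u_j)` of a sequence of monomials. For the first index
it is `0 : (u_1)`. -/
def colonIdeal {r : ℕ} (u : Fin r → Finset (Fin n)) (j : Fin r) : Ideal (ExtAlg K n) :=
  (monoIdeal K (u '' Set.Iio j)).colon
    (Ideal.span {mono K (u j)} : Set (ExtAlg K n))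

variable (K) in
/-- `set(u_j) = {k : e_k ∈ (u_1, …, u_{j-1}) : (u_j)}`. -/
def qset {r : ℕ} (u : Fin r → Finset (Fin n)) (j : Fin r) : Set (Fin n) :=
  {k | var K k ∈ colonIdeal (K := K) u j}

/-- `u_1, …, u_r` is a listing of `G(I)` without repetition, of weakly increasing degree, for
which `I` has linear quotients: each ideal `0 : (u_1)`, `(u_1, …, u_{j-1}) : (u_j)` is generated
by a subset of `{e_1, …, e_n}`. -/
structure HasLinearQuotients (I : Ideal (ExtAlg K n)) {r : ℕ} (u : Fin r → Finset (Fin n)) :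
    Prop where
  injective : Function.Injective u
  range_eq : Set.range u = minGens I
  degree_mono : Monotone fun j => (u j).card
  linear : ∀ j, ∃ S : Set (Fin n), colonIdeal u j = Ideal.span (var K '' S)

end LinearQuotients

section Tor

/-! ### Graded `Tor` over the exterior algebra

For a left `E`-module `M` the bar resolution `⋯ → P_1 → P_0 → M → 0` is the exact complex of free
left `E`-modules given by `P_{-1} = M`, `P_i = E ⊗_K P_{i-1}`, whose differentials
`d_i : P_i → P_{i-1}` are the `E`-linear maps with `d_0 (a ⊗ m) = a m` and
`d_{i+1} (a ⊗ x) = a x - a ⊗ d_i x` (so `x ↦ 1 ⊗ x` is a contracting homotopy). Unfolding the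
recursion, this is the usual alternating sum
`a_0 ⊗ ⋯ ⊗ a_i ⊗ m ↦ ∑_k (-1)^k a_0 ⊗ ⋯ ⊗ a_k a_{k+1} ⊗ ⋯ ⊗ m`.
`Tor_i^E(M, K)` is the homology of the complex `K ⊗_E P`, where
`K ⊗_E P_i = P_{i-1} = E^{⊗ i} ⊗ M`. -/

variable (K : Type u) [Field K] (n : ℕ)

/-- The map `E ⊗ X → K ⊗ X = X` induced by the augmentation `E → E/(e_1, …, e_n) = K`. -/
def augMap (X : Type u) [AddCommGroup X] [Module K X] : ExtAlg K n ⊗[K] X →ₗ[K] X :=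
  (TensorProduct.lid K X).toLinearMap ∘ₗ
    TensorProduct.map (ExteriorAlgebra.algebraMapInv (R := K) (M := Fin n → K)).toLinearMap
      LinearMap.id

/-- The data attached to the `i`-th step of the construction (see `barStage`, where it is built):
the space `X = E^{⊗ i} ⊗ M = P_{i-1} = K ⊗_E P_i`, the differential
`d = d_i : P_i = E ⊗ X → X` of the bar resolution, the homogeneous parts `gr j` of `X`, and the
kernel `ker` of the differential `K ⊗_E P_i → K ⊗_E P_{i-1}` (all of `X` for `i = 0`). -/
structure BarStage where
  X : Type u
  [addCommGroup : AddCommGroup X]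
  [module : Module K X]
  d : ExtAlg K n ⊗[K] X →ₗ[K] X
  gr : ℕ → Submodule K X
  ker : Submodule K X

attribute [instance] BarStage.addCommGroup BarStage.module

variable {K n}

/-- The differential `K ⊗_E P_{i+1} → K ⊗_E P_i`: it sends `x ∈ P_i = K ⊗_E P_{i+1}` to the image
of `d_{i+1} (1 ⊗ x) = x - 1 ⊗ d_i x` in `K ⊗_E P_i`. -/
def BarStage.torD (S : BarStage K n) : ExtAlg K n ⊗[K] S.X →ₗ[K] S.X :=
  augMap K n S.X - S.d

/-- The grading of `E ⊗ X`: the degree `j` part is `∑_{p + q = j} E_p ⊗ X_q`. -/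
def tensorGr {X : Type u} [AddCommGroup X] [Module K X] (gr : ℕ → Submodule K X) (j : ℕ) :
    Submodule K (ExtAlg K n ⊗[K] X) :=
  ⨆ (p : ℕ) (q : ℕ) (_ : p + q = j),
    Submodule.map₂ (TensorProduct.mk K (ExtAlg K n) X) (⋀[K]^p (Fin n → K)) (gr q)

/-- The passage from step `i` to step `i + 1`. -/
abbrev BarStage.next (S : BarStage K n) : BarStage K n where
  X := ExtAlg K n ⊗[K] S.X
  d := TensorProduct.map (LinearMap.mul' K (ExtAlg K n)) LinearMap.id ∘ₗ
      (TensorProduct.assoc K (ExtAlg K n) (ExtAlg K n) S.X).symm.toLinearMap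
    - TensorProduct.map LinearMap.id S.d
  gr := tensorGr S.gr
  ker := LinearMap.ker S.torD

variable {M : Type u} [AddCommGroup M] [Module K M] [Module (ExtAlg K n) M]
  [IsScalarTower K (ExtAlg K n) M]

/-- The `i`-th step of the construction for the `E`-module `M` with homogeneous parts `gr j`. -/
def barStage (gr : ℕ → Submodule K M) : ℕ → BarStage K n
  | 0 =>
    { X := M
      d := TensorProduct.lift
        (Algebra.lsmul K K M : ExtAlg K n →ₐ[K] Module.End K M).toLinearMap
      gr := gr
      ker := ⊤ }
  | i + 1 => (barStage gr i).next

/-- The degree `j` part of the homology at step `i`: cycles of degree `j` modulo the image of the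
chains of degree `j` under the incoming differential. -/
abbrev BarStage.Homology (S : BarStage K n) (j : ℕ) : Type u :=
  ↥(S.ker ⊓ S.gr j) ⧸ ((tensorGr S.gr j).map S.torD).submoduleOf (S.ker ⊓ S.gr j)

/-- `Tor_i^E(M, K)_j` for the `E`-module `M` with homogeneous parts `gr j`. -/
abbrev GradedTor (gr : ℕ → Submodule K M) (i j : ℕ) : Type u :=
  (barStage (n := n) gr i).Homology j

end Tor

section Poincare

variable {K : Type u} [Field K] {n : ℕ}

/-- The grading `I_j = I ∩ ⋀^j V` of an ideal `I` of `E`. -/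
def idealDeg (I : Ideal (ExtAlg K n)) (j : ℕ) : Submodule K I :=
  (⋀[K]^j (Fin n → K)).comap (I.subtype.restrictScalars K)

/-- The graded Betti number `β_{i,j}(I) = dim_K Tor_i^E(I, K)_j`. -/
def gradedBetti (I : Ideal (ExtAlg K n)) (i j : ℕ) : ℕ :=
  Module.finrank K (GradedTor (n := n) (idealDeg I) i j)

/-- The variable `s` of `ℤ⟦s, t⟧`. -/
def sVar : MvPowerSeries (Fin 2) ℤ := MvPowerSeries.X 0

/-- The variable `t` of `ℤ⟦s, t⟧`. -/
def tVar : MvPowerSeries (Fin 2) ℤ := MvPowerSeries.X 1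

/-- The graded Poincaré series `P_I(s, t) = ∑_{i, j ≥ 0} β_{i,j}(I) t^i s^j`: the coefficient of
`s^a t^b` is `β_{b,a}(I)`. -/
def poincareSeries (I : Ideal (ExtAlg K n)) : MvPowerSeries (Fin 2) ℤ :=
  fun m => (gradedBetti I (m 1) (m 0) : ℤ)

end Poincare

end ExtLinQuot

end

open scoped TensorProduct MvPowerSeries.WithPiTopology

noncomputable section

namespace ExtLinQuot

universe u

/-! ### Monomials: products and membership in monomial ideals. -/

section MonomialProducts

variable (K : Type u) [Field K] {n : ℕ}

/-! The generators are added one at a time. Let J = (u_1, …, u_{k-1}) and S = set(u_k), which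
contains the support of u_k. By linear quotients, (J + (u_k))/J is a shift of E/(e_l : l ∈ S), and
this is a shift of the principal ideal (e_S). Concretely, right multiplication by the monomial on S
minus the support of u_k kills J and sends u_k to ±e_S, which gives 0 → J → J + (u_k) → (e_S) → 0 up
to shift (`nonempty_colonSES`, a case of `nonempty_monoIdealSES`).

In the degrees of J + (u_k), Tor_{i+1} of the quotient lives in degree i + 1 + deg u_k only, while
Tor_i of J lives in degrees at most i + deg u_k, because the degrees of the generators increase
weakly. So the connecting maps vanish and Betti numbers add (`gradedBetti_add`).

There remain the Betti numbers of (e_S) (`gradedBetti_monoIdeal_singleton`), found by induction on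
|S|. For l ∉ S, multiplication by e_l gives 0 → (e_{S ∪ l}) → (e_S) → (e_{S ∪ l})(1) → 0. Now the
inclusion induces zero on Tor for degree reasons, and the dimension count is Pascal's rule. The
start S = ∅ is the free module E, whose bar complex is contractible.

All Tor statements are dimension counts in the bar complex. A sequence of E-modules split over K by
homogeneous maps stays split at every stage, since each stage is only tensored with E over K. -/

theorem mono_mul_of_not_disjoint {μ ν : Finset (Fin n)} (h : ¬Disjoint μ ν) :
    mono K μ * mono K ν = 0 :=
  ExteriorAlgebra.basis_mul_of_not_disjoint (Pi.basisFun K (Fin n))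
    (⟨μ, rfl⟩ : Set.powersetCard (Fin n) μ.card) (⟨ν, rfl⟩ : Set.powersetCard (Fin n) ν.card) h

/-- The scalar is the sign ±1 of a shuffle; only its being nonzero is used later, so the sign is
forgotten here. -/
theorem exists_mono_mul_of_disjoint {μ ν : Finset (Fin n)} (h : Disjoint μ ν) :
    ∃ c : K, c ≠ 0 ∧ mono K μ * mono K ν = c • mono K (μ ∪ ν) := by
  have key := ExteriorAlgebra.basis_mul_of_disjoint (Pi.basisFun K (Fin n))
    (⟨μ, rfl⟩ : Set.powersetCard (Fin n) μ.card) (⟨ν, rfl⟩ : Set.powersetCard (Fin n) ν.card) h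
  have hset : ((Set.powersetCard.disjUnion (s := (⟨μ, rfl⟩ : Set.powersetCard (Fin n) μ.card))
      (t := (⟨ν, rfl⟩ : Set.powersetCard (Fin n) ν.card)) h : Set.powersetCard (Fin n) _) :
      Finset (Fin n)) = μ ∪ ν := by
    simp [Set.powersetCard.disjUnion]
  rw [hset] at key
  generalize Equiv.Perm.sign (Set.powersetCard.permOfDisjoint
    (s := (⟨μ, rfl⟩ : Set.powersetCard (Fin n) μ.card))
    (t := (⟨ν, rfl⟩ : Set.powersetCard (Fin n) ν.card)) h) = s at key
  rcases Int.units_eq_one_or s with h1 | h1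
  · refine ⟨1, one_ne_zero, ?_⟩
    rw [h1] at key
    simpa [mono] using key
  · refine ⟨-1, by simp, ?_⟩
    rw [h1] at key
    simpa [mono] using key

theorem mono_empty : mono K (∅ : Finset (Fin n)) = 1 := by
  rw [mono, ExteriorAlgebra.basis_apply_ofCard _ (Finset.card_empty)]
  simp [ExteriorAlgebra.ιMulti_family]

theorem var_eq_mono (k : Fin n) : var K k = mono K {k} := by
  rw [mono, ExteriorAlgebra.basis_apply_ofCard _ (Finset.card_singleton k)]
  simp [ExteriorAlgebra.ιMulti_family, ExteriorAlgebra.ιMulti_apply, var,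
    Set.powersetCard.ofFinEmbEquiv_symm_apply, Set.powersetCard.ofCard]

theorem mono_mem_exteriorPower (μ : Finset (Fin n)) : mono K μ ∈ ⋀[K]^μ.card (Fin n → K) := by
  have := ExteriorAlgebra.basis_eq_coe_basis (Pi.basisFun K (Fin n))
    (⟨μ, rfl⟩ : Set.powersetCard (Fin n) μ.card)
  rw [mono]
  exact this ▸ Subtype.coe_prop _

theorem exteriorPower_eq_span (j : ℕ) :
    ⋀[K]^j (Fin n → K) = Submodule.span K (mono K '' {μ | μ.card = j}) := by
  apply le_antisymm
  · intro x hx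
    have h := ((Pi.basisFun K (Fin n)).exteriorPower j).mem_span ⟨x, hx⟩
    have h2 := Submodule.mem_map_of_mem (f := (⋀[K]^j (Fin n → K)).subtype) h
    rw [Submodule.map_span] at h2
    refine Submodule.span_mono ?_ h2
    rintro _ ⟨_, ⟨s, rfl⟩, rfl⟩
    refine ⟨s, s.2, ?_⟩
    rw [mono, ExteriorAlgebra.basis_eq_coe_basis]
    rfl
  · rw [Submodule.span_le]
    rintro _ ⟨μ, rfl, rfl⟩
    exact mono_mem_exteriorPower K μ

theorem span_range_mono : Submodule.span K (Set.range (mono K (n := n))) = ⊤ :=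
  (Pi.basisFun K (Fin n)).ExteriorAlgebra.span_eq

theorem mono_mem_span {U : Set (Finset (Fin n))} {μ : Finset (Fin n)} :
    mono K μ ∈ Submodule.span K (mono K '' U) ↔ μ ∈ U := by
  rw [show mono K (n := n) = (Pi.basisFun K (Fin n)).ExteriorAlgebra from rfl,
    Module.Basis.mem_span_image, Module.Basis.repr_self,
    Finsupp.support_single _ one_ne_zero]
  simp

/-- The supports of the monomials that are divisible by some `e_μ`, `μ ∈ S`. -/
def multiples (S : Set (Finset (Fin n))) : Set (Finset (Fin n)) := {ν | ∃ μ ∈ S, μ ⊆ ν}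

theorem mul_mono_mem_span {S : Set (Finset (Fin n))} {x : ExtAlg K n}
    (hx : x ∈ Submodule.span K (mono K '' multiples S)) (μ : Finset (Fin n)) :
    x * mono K μ ∈ Submodule.span K (mono K '' multiples S) := by
  induction hx using Submodule.span_induction with
  | mem x hx =>
    obtain ⟨ν, ⟨ρ, hρ, hρν⟩, rfl⟩ := hx
    by_cases h : Disjoint ν μ
    · obtain ⟨c, -, hc⟩ := exists_mono_mul_of_disjoint K h
      rw [hc]
      exact Submodule.smul_mem _ _ (Submodule.subset_span
        ⟨_, ⟨ρ, hρ, hρν.trans Finset.subset_union_left⟩, rfl⟩)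
    · rw [mono_mul_of_not_disjoint K h]
      exact zero_mem _
  | zero => simp
  | add x y _ _ hx hy => rw [add_mul]; exact add_mem hx hy
  | smul a x _ hx => rw [smul_mul_assoc]; exact Submodule.smul_mem _ _ hx

theorem mono_mul_mem_span {S : Set (Finset (Fin n))} {x : ExtAlg K n}
    (hx : x ∈ Submodule.span K (mono K '' multiples S)) (μ : Finset (Fin n)) :
    mono K μ * x ∈ Submodule.span K (mono K '' multiples S) := by
  induction hx using Submodule.span_induction with
  | mem x hx =>
    obtain ⟨ν, ⟨ρ, hρ, hρν⟩, rfl⟩ := hx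
    by_cases h : Disjoint μ ν
    · obtain ⟨c, -, hc⟩ := exists_mono_mul_of_disjoint K h
      rw [hc]
      exact Submodule.smul_mem _ _ (Submodule.subset_span
        ⟨_, ⟨ρ, hρ, hρν.trans Finset.subset_union_right⟩, rfl⟩)
    · rw [mono_mul_of_not_disjoint K h]
      exact zero_mem _
  | zero => simp
  | add x y _ _ hx hy => rw [mul_add]; exact add_mem hx hy
  | smul a x _ hx => rw [mul_smul_comm]; exact Submodule.smul_mem _ _ hx

theorem mem_span_range_mono (x : ExtAlg K n) : x ∈ Submodule.span K (Set.range (mono K)) := by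
  rw [span_range_mono]; trivial

theorem mul_mem_span_left {S : Set (Finset (Fin n))} {x : ExtAlg K n}
    (hx : x ∈ Submodule.span K (mono K '' multiples S)) (y : ExtAlg K n) :
    y * x ∈ Submodule.span K (mono K '' multiples S) := by
  induction mem_span_range_mono K y using Submodule.span_induction with
  | mem y hy => obtain ⟨μ, rfl⟩ := hy; exact mono_mul_mem_span K hx μ
  | zero => simp
  | add y z _ _ hy hz => rw [add_mul]; exact add_mem hy hz
  | smul a y _ hy => rw [smul_mul_assoc]; exact Submodule.smul_mem _ _ hy

/-- Products of monomials are scalar multiples of monomials, so a monomial ideal is the K-span of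
the monomials it contains. This turns questions about such ideals into combinatorics of supports. -/
theorem mem_monoIdeal_iff {S : Set (Finset (Fin n))} {x : ExtAlg K n} :
    x ∈ monoIdeal K S ↔ x ∈ Submodule.span K (mono K '' multiples S) := by
  constructor
  · intro hx
    induction hx using Submodule.span_induction with
    | mem x hx =>
      obtain ⟨μ, hμ, rfl⟩ := hx
      exact Submodule.subset_span ⟨μ, ⟨μ, hμ, subset_rfl⟩, rfl⟩
    | zero => simp
    | add x y _ _ hx hy => exact add_mem hx hy
    | smul a x _ hx => exact mul_mem_span_left K hx a
  · intro hx
    suffices Submodule.span K (mono K '' multiples S) ≤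
        (monoIdeal K S).restrictScalars K from this hx
    rw [Submodule.span_le]
    rintro _ ⟨ν, ⟨μ, hμ, hμν⟩, rfl⟩
    obtain ⟨c, hc, h⟩ := exists_mono_mul_of_disjoint K (Finset.sdiff_disjoint (s := μ) (t := ν))
    rw [Finset.sdiff_union_of_subset hμν] at h
    have : mono K ν = c⁻¹ • (mono K (ν \ μ) * mono K μ) := by rw [h, inv_smul_smul₀ hc]
    rw [this, ← smul_mul_assoc]
    exact Ideal.mul_mem_left _ _ (Ideal.subset_span ⟨μ, hμ, rfl⟩)

theorem mono_mem_monoIdeal {S : Set (Finset (Fin n))} {ν : Finset (Fin n)} :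
    mono K ν ∈ monoIdeal K S ↔ ∃ μ ∈ S, μ ⊆ ν := by
  rw [mem_monoIdeal_iff, mono_mem_span]; rfl

theorem mul_mono_mem_monoIdeal {S : Set (Finset (Fin n))} {x : ExtAlg K n}
    (hx : x ∈ monoIdeal K S) (μ : Finset (Fin n)) : x * mono K μ ∈ monoIdeal K S := by
  rw [mem_monoIdeal_iff] at *
  exact mul_mono_mem_span K hx μ

end MonomialProducts

/-! ### A dimension count for exact sequences. -/

section FinrankLemmas

variable {K X Y Z : Type*} [Field K] [AddCommGroup X] [Module K X] [AddCommGroup Y] [Module K Y]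
  [AddCommGroup Z] [Module K Z]

/-- Rank-nullity for g restricted to W; exactness identifies the kernel with the part of W coming
from X. -/
theorem finrank_eq_finrank_comap_add_finrank_map [Module.Finite K Y] {f : X →ₗ[K] Y}
    {g : Y →ₗ[K] Z} (hf : Function.Injective f) (hfg : Function.Exact f g) (W : Submodule K Y) :
    Module.finrank K W = Module.finrank K (W.comap f) + Module.finrank K (W.map g) := by
  have h1 := (g.domRestrict W).finrank_range_add_finrank_ker
  have h2 : Module.finrank K (LinearMap.range (g.domRestrict W)) = Module.finrank K (W.map g) := by
    rw [LinearMap.range_domRestrict]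
  have h3 : (LinearMap.ker (g.domRestrict W)).map W.subtype = (W.comap f).map f := by
    ext y
    simp only [Submodule.mem_map, LinearMap.mem_ker, Submodule.mem_comap, Submodule.subtype_apply,
      Subtype.exists, LinearMap.domRestrict_apply]
    constructor
    · rintro ⟨y, hy, hgy, rfl⟩
      obtain ⟨x, rfl⟩ := (hfg y).1 hgy
      exact ⟨x, hy, rfl⟩
    · rintro ⟨x, hx, rfl⟩
      exact ⟨f x, hx, (hfg _).2 ⟨x, rfl⟩, rfl⟩
  have h4 : Module.finrank K ((LinearMap.ker (g.domRestrict W)).map W.subtype) =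
      Module.finrank K ((W.comap f).map f) := by rw [h3]
  rw [(Submodule.equivMapOfInjective _ W.injective_subtype _).symm.finrank_eq,
    (Submodule.equivMapOfInjective _ hf _).symm.finrank_eq] at h4
  omega

end FinrankLemmas

/-! ### The total grading on E ⊗ X. -/

section TensorGrading

variable {K : Type u} [Field K] {n : ℕ} {X Y : Type u} [AddCommGroup X] [Module K X]
  [AddCommGroup Y] [Module K Y]

theorem augMap_tmul (a : ExtAlg K n) (x : X) :
    augMap K n X (a ⊗ₜ x) = ExteriorAlgebra.algebraMapInv a • x := by
  simp [augMap]

theorem augMap_lTensor (f : X →ₗ[K] Y) (z : ExtAlg K n ⊗[K] X) :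
    augMap K n Y (f.lTensor _ z) = f (augMap K n X z) := by
  induction z with
  | zero => simp
  | tmul a x => simp [augMap_tmul]
  | add x y hx hy => simp [hx, hy]

theorem tmul_mem_tensorGr {gr : ℕ → Submodule K X} {p q : ℕ} {a : ExtAlg K n} {x : X}
    (ha : a ∈ ⋀[K]^p (Fin n → K)) (hx : x ∈ gr q) : a ⊗ₜ[K] x ∈ tensorGr (n := n) gr (p + q) :=
  (le_iSup_of_le p <| le_iSup_of_le q <| le_iSup_of_le rfl le_rfl :
    Submodule.map₂ (TensorProduct.mk K (ExtAlg K n) X) (⋀[K]^p (Fin n → K)) (gr q) ≤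
      tensorGr gr (p + q)) (Submodule.apply_mem_map₂ _ ha hx)

theorem tensorGr_le {gr : ℕ → Submodule K X} {j : ℕ} {W : Submodule K (ExtAlg K n ⊗[K] X)}
    (h : ∀ p q, p + q = j → ∀ a ∈ ⋀[K]^p (Fin n → K), ∀ x ∈ gr q, a ⊗ₜ[K] x ∈ W) :
    tensorGr gr j ≤ W :=
  iSup_le fun p => iSup_le fun q => iSup_le fun hpq => Submodule.map₂_le.2 (h p q hpq)

theorem tensorGr_eq_bot {gr : ℕ → Submodule K X} {j : ℕ} (h : ∀ q ≤ j, gr q = ⊥) :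
    tensorGr (n := n) gr j = ⊥ := by
  rw [eq_bot_iff]
  apply tensorGr_le
  intro p q hpq a _ x hx
  rw [h q (by omega), Submodule.mem_bot] at hx
  simp [hx]

theorem lTensor_mem_tensorGr {gr : ℕ → Submodule K X} {gr' : ℕ → Submodule K Y} {c : ℕ}
    {f : X →ₗ[K] Y} (h : ∀ q, ∀ x ∈ gr q, f x ∈ gr' (q + c)) {j : ℕ} {z : ExtAlg K n ⊗[K] X}
    (hz : z ∈ tensorGr gr j) : f.lTensor _ z ∈ tensorGr gr' (j + c) := by
  suffices tensorGr gr j ≤ (tensorGr gr' (j + c)).comap (f.lTensor (ExtAlg K n)) from this hz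
  apply tensorGr_le
  rintro p q rfl a ha x hx
  rw [add_assoc]
  exact tmul_mem_tensorGr ha (h q x hx)

/-- Degrees are natural numbers, so lowering by c makes sense only from degree c on; `h0` disposes
of the summands E_p ⊗ X_q with q < c. -/
theorem lTensor_mem_tensorGr_of_shift {gr : ℕ → Submodule K X} {gr' : ℕ → Submodule K Y} {c : ℕ}
    {f : X →ₗ[K] Y} (h : ∀ q, ∀ x ∈ gr (q + c), f x ∈ gr' q) (h0 : ∀ q < c, gr q = ⊥) {j : ℕ}
    {z : ExtAlg K n ⊗[K] X} (hz : z ∈ tensorGr gr (j + c)) : f.lTensor _ z ∈ tensorGr gr' j := by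
  suffices tensorGr gr (j + c) ≤ (tensorGr gr' j).comap (f.lTensor (ExtAlg K n)) from this hz
  apply tensorGr_le
  intro p q hpq a ha x hx
  rcases lt_or_ge q c with hq | hq
  · rw [h0 q hq, Submodule.mem_bot] at hx
    simp [hx]
  · obtain ⟨q, rfl⟩ := Nat.exists_eq_add_of_le' hq
    obtain rfl : p + q = j := by omega
    exact tmul_mem_tensorGr ha (h q x hx)

theorem algebraMapInv_of_mem_exteriorPower {p : ℕ} (hp : p ≠ 0) {a : ExtAlg K n}
    (ha : a ∈ ⋀[K]^p (Fin n → K)) : ExteriorAlgebra.algebraMapInv a = 0 := by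
  rw [← ExteriorAlgebra.ιMulti_span_fixedDegree] at ha
  induction ha using Submodule.span_induction with
  | mem x hx =>
    obtain ⟨v, rfl⟩ := hx
    obtain ⟨p, rfl⟩ := Nat.exists_eq_succ_of_ne_zero hp
    rw [ExteriorAlgebra.ιMulti_succ_apply, map_mul]
    simp [ExteriorAlgebra.algebraMapInv]
  | zero => simp
  | add x y _ _ hx hy => simp [hx, hy]
  | smul a x _ hx => simp [hx]

theorem augMap_mem {gr : ℕ → Submodule K X} {j : ℕ} {z : ExtAlg K n ⊗[K] X}
    (hz : z ∈ tensorGr gr j) : augMap K n X z ∈ gr j := by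
  suffices tensorGr gr j ≤ (gr j).comap (augMap K n X) from this hz
  apply tensorGr_le
  intro p q hpq a ha x hx
  rw [Submodule.mem_comap, augMap_tmul]
  by_cases hp : p = 0
  · obtain rfl : q = j := by omega
    exact Submodule.smul_mem _ _ hx
  · rw [algebraMapInv_of_mem_exteriorPower hp ha, zero_smul]
    exact zero_mem _

end TensorGrading

/-! ### The bar complex, and short exact sequences of its stages. -/

namespace BarStage

variable {K : Type u} [Field K] {n : ℕ}

/-- The properties of a stage that make the construction a complex of graded vector spaces. -/
structure IsGood (S : BarStage K n) : Prop where
  finite : Module.Finite K S.X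
  d_mul_tmul : ∀ a b x, S.d ((a * b) ⊗ₜ x) = S.d (a ⊗ₜ S.d (b ⊗ₜ x))
  d_mem : ∀ j, ∀ z ∈ tensorGr S.gr j, S.d z ∈ S.gr j
  torD_mem : ∀ z, S.torD z ∈ S.ker

theorem torD_apply (S : BarStage K n) (z : ExtAlg K n ⊗[K] S.X) :
    S.torD z = augMap K n S.X z - S.d z := rfl

theorem next_d_tmul (S : BarStage K n) (a b : ExtAlg K n) (x : S.X) :
    S.next.d (a ⊗ₜ (b ⊗ₜ x)) = (a * b) ⊗ₜ x - a ⊗ₜ S.d (b ⊗ₜ x) := by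
  simp

instance : Module.Finite K (ExtAlg K n) :=
  Module.Finite.of_basis (Pi.basisFun K (Fin n)).ExteriorAlgebra

theorem tensor_ext₂ {X Y : Type u} [AddCommGroup X] [Module K X] [AddCommGroup Y] [Module K Y]
    {f g : ExtAlg K n ⊗[K] (ExtAlg K n ⊗[K] X) →ₗ[K] Y}
    (h : ∀ a b x, f (a ⊗ₜ (b ⊗ₜ x)) = g (a ⊗ₜ (b ⊗ₜ x))) : f = g := by
  refine TensorProduct.ext' fun a y => ?_
  induction y using TensorProduct.induction_on with
  | zero => simp
  | tmul b x => exact h a b x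
  | add x y hx hy => simp only [TensorProduct.tmul_add, map_add, hx, hy]

theorem IsGood.d_next_d {S : BarStage K n} (hS : S.IsGood) (z : S.next.next.X) :
    S.d (S.next.d z) = 0 := by
  have : S.d ∘ₗ S.next.d = 0 := tensor_ext₂ fun a b x => by
    rw [LinearMap.comp_apply, next_d_tmul, map_sub, hS.d_mul_tmul, sub_self]
    rfl
  exact LinearMap.congr_fun this z

theorem IsGood.torD_next_torD {S : BarStage K n} (hS : S.IsGood) (z : S.next.next.X) :
    S.torD (S.next.torD z) = 0 := by
  have : S.torD ∘ₗ S.next.torD = 0 := tensor_ext₂ fun a b x => by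
    rw [LinearMap.comp_apply, torD_apply S.next, next_d_tmul, augMap_tmul]
    simp only [map_sub, map_smul, torD_apply, augMap_tmul, map_mul, hS.d_mul_tmul, mul_smul,
      smul_sub, LinearMap.zero_apply]
    abel
  exact LinearMap.congr_fun this z

theorem IsGood.torD_mem_gr {S : BarStage K n} (hS : S.IsGood) {j : ℕ} {z}
    (hz : z ∈ tensorGr S.gr j) : S.torD z ∈ S.gr j :=
  sub_mem (augMap_mem hz) (hS.d_mem j z hz)

theorem mul_mem_exteriorPower {p q : ℕ} {a b : ExtAlg K n} (ha : a ∈ ⋀[K]^p (Fin n → K))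
    (hb : b ∈ ⋀[K]^q (Fin n → K)) : a * b ∈ ⋀[K]^(p + q) (Fin n → K) :=
  SetLike.mul_mem_graded (A := fun i : ℕ => ⋀[K]^i (Fin n → K)) ha hb

theorem next_d_mul_tmul (S : BarStage K n) (a b : ExtAlg K n) (x : S.next.X) :
    S.next.d ((a * b) ⊗ₜ x) = LinearMap.rTensor S.X (LinearMap.mulLeft K a) (S.next.d (b ⊗ₜ x)) := by
  induction x using TensorProduct.induction_on with
  | zero => simp
  | tmul c y =>
    rw [next_d_tmul, next_d_tmul, map_sub, LinearMap.rTensor_tmul, LinearMap.rTensor_tmul,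
      LinearMap.mulLeft_apply, LinearMap.mulLeft_apply, mul_assoc]
  | add x y hx hy => simp only [TensorProduct.tmul_add, map_add, hx, hy]

theorem next_d_tmul_eq (S : BarStage K n) (a : ExtAlg K n) (x : S.next.X) :
    S.next.d (a ⊗ₜ x) = LinearMap.rTensor S.X (LinearMap.mulLeft K a) x - a ⊗ₜ S.d x := by
  induction x using TensorProduct.induction_on with
  | zero => simp
  | tmul c y => rw [next_d_tmul, LinearMap.rTensor_tmul, LinearMap.mulLeft_apply]
  | add x y hx hy =>
    simp only [TensorProduct.tmul_add, map_add, hx, hy]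
    abel

theorem IsGood.next {S : BarStage K n} (hS : S.IsGood) : S.next.IsGood where
  finite := by
    have := hS.finite
    change Module.Finite K (ExtAlg K n ⊗[K] S.X)
    infer_instance
  d_mul_tmul a b x := by
    -- The differential is linear for left multiplication on the first factor, and the correction
    -- term a ⊗ d(d(b ⊗ x)) vanishes because d² = 0.
    rw [next_d_mul_tmul, next_d_tmul_eq S a, hS.d_next_d, TensorProduct.tmul_zero, sub_zero]
  d_mem j z hz := by
    suffices tensorGr (tensorGr S.gr) j ≤ (tensorGr S.gr j).comap S.next.d from this hz
    apply tensorGr_le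
    intro p q hpq a ha x hx
    suffices tensorGr S.gr q ≤ (tensorGr S.gr j).comap
      (S.next.d ∘ₗ TensorProduct.mk K (ExtAlg K n) (ExtAlg K n ⊗[K] S.X) a) from this hx
    apply tensorGr_le
    intro p' q' hpq' b hb y hy
    rw [Submodule.mem_comap, LinearMap.comp_apply, TensorProduct.mk_apply, next_d_tmul]
    apply sub_mem
    · rw [← hpq, ← hpq', ← add_assoc]
      exact tmul_mem_tensorGr (mul_mem_exteriorPower ha hb) hy
    · rw [← hpq]
      exact tmul_mem_tensorGr ha (hS.d_mem q _ (hpq' ▸ tmul_mem_tensorGr hb hy))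
  torD_mem z := hS.torD_next_torD z

/-- The space of boundaries of degree `j`. -/
abbrev boundaries (S : BarStage K n) (j : ℕ) : Submodule K S.X := (tensorGr S.gr j).map S.torD

/-- The space of cycles of degree `j`. -/
abbrev cycles (S : BarStage K n) (j : ℕ) : Submodule K S.X := S.ker ⊓ S.gr j

/-- The dimension of the homology in degree `j`. -/
def homDim (S : BarStage K n) (j : ℕ) : ℕ := Module.finrank K (S.Homology j)

theorem IsGood.boundaries_le_cycles {S : BarStage K n} (hS : S.IsGood) (j : ℕ) :
    S.boundaries j ≤ S.cycles j := by
  rintro _ ⟨z, hz, rfl⟩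
  exact ⟨hS.torD_mem z, hS.torD_mem_gr hz⟩

theorem IsGood.homDim_add {S : BarStage K n} (hS : S.IsGood) (j : ℕ) :
    S.homDim j + Module.finrank K (S.boundaries j) = Module.finrank K (S.cycles j) := by
  have := hS.finite
  have h := Submodule.finrank_quotient_add_finrank ((S.boundaries j).submoduleOf (S.cycles j))
  rwa [(Submodule.submoduleOfEquivOfLe (hS.boundaries_le_cycles j)).finrank_eq] at h

theorem IsGood.cycles_le_boundaries {S : BarStage K n} (hS : S.IsGood) {j : ℕ}
    (h : S.homDim j = 0) : S.cycles j ≤ S.boundaries j := by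
  have := hS.finite
  have h2 := hS.homDim_add j
  exact (Submodule.eq_of_le_of_finrank_eq (hS.boundaries_le_cycles j) (by omega)).ge

/-- Rank-nullity for `torD` in degree j. Together with `homDim_add` it expresses Betti numbers
through dimensions of chains and boundaries alone. -/
theorem IsGood.finrank_cycles_next {S : BarStage K n} (hS : S.IsGood) (j : ℕ) :
    Module.finrank K (S.next.cycles j) + Module.finrank K (S.boundaries j) =
      Module.finrank K (S.next.gr j) := by
  have := hS.finite
  have hex : Function.Exact (LinearMap.ker S.torD).subtype S.torD := fun y =>
    ⟨fun h => ⟨⟨y, h⟩, rfl⟩, by rintro ⟨x, rfl⟩; exact x.2⟩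
  rw [finrank_eq_finrank_comap_add_finrank_map (Submodule.injective_subtype _) hex
    (tensorGr S.gr j), (Submodule.equivMapOfInjective _ (Submodule.injective_subtype (LinearMap.ker S.torD))
    _).finrank_eq, Submodule.map_comap_subtype]

/-- A short exact sequence of stages `0 → A → B → C(c) → 0` which is compatible with the
differentials and split by homogeneous linear maps. -/
structure SplitSES (A B C : BarStage K n) (c : ℕ) where
  f : A.X →ₗ[K] B.X
  r : B.X →ₗ[K] A.X
  g : B.X →ₗ[K] C.X
  s : C.X →ₗ[K] B.X
  r_comp_f : r ∘ₗ f = LinearMap.id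
  g_comp_s : g ∘ₗ s = LinearMap.id
  g_comp_f : g ∘ₗ f = 0
  f_comp_r_add : f ∘ₗ r + s ∘ₗ g = LinearMap.id
  f_comp_d : f ∘ₗ A.d = B.d ∘ₗ f.lTensor _
  g_comp_d : g ∘ₗ B.d = C.d ∘ₗ g.lTensor _
  f_mem : ∀ j, ∀ x ∈ A.gr j, f x ∈ B.gr j
  r_mem : ∀ j, ∀ x ∈ B.gr j, r x ∈ A.gr j
  g_mem : ∀ j, ∀ x ∈ B.gr j, g x ∈ C.gr (j + c)
  s_mem : ∀ j, ∀ x ∈ C.gr (j + c), s x ∈ B.gr j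
  gr_eq_bot : ∀ q < c, C.gr q = ⊥
  mem_ker : ∀ x, f x ∈ B.ker → x ∈ A.ker

namespace SplitSES

variable {A B C : BarStage K n} {c : ℕ} (E : SplitSES A B C c)

include E

theorem f_torD (z) : E.f (A.torD z) = B.torD (E.f.lTensor _ z) := by
  rw [torD_apply, torD_apply, map_sub, augMap_lTensor]
  congr 1
  exact LinearMap.congr_fun E.f_comp_d z

theorem g_torD (z) : E.g (B.torD z) = C.torD (E.g.lTensor _ z) := by
  rw [torD_apply, torD_apply, map_sub, augMap_lTensor]
  congr 1
  exact LinearMap.congr_fun E.g_comp_d z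

theorem r_f (x) : E.r (E.f x) = x := LinearMap.congr_fun E.r_comp_f x

theorem g_s (x) : E.g (E.s x) = x := LinearMap.congr_fun E.g_comp_s x

theorem g_f (x) : E.g (E.f x) = 0 := LinearMap.congr_fun E.g_comp_f x

theorem f_r_add (x) : E.f (E.r x) + E.s (E.g x) = x := LinearMap.congr_fun E.f_comp_r_add x

theorem injective : Function.Injective E.f := Function.LeftInverse.injective E.r_f

theorem exact : Function.Exact E.f E.g := fun y =>
  ⟨fun h => ⟨E.r y, by simpa [h] using E.f_r_add y⟩, by rintro ⟨x, rfl⟩; exact E.g_f x⟩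

theorem mem_gr_of_f_mem {j : ℕ} {x} (h : E.f x ∈ B.gr j) : x ∈ A.gr j := by
  simpa [E.r_f] using E.r_mem j _ h

omit E in
/-- The short exact sequence that is induced on the next stages. -/
def next (E : SplitSES A B C c) : SplitSES A.next B.next C.next c where
  f := E.f.lTensor _
  r := E.r.lTensor _
  g := E.g.lTensor _
  s := E.s.lTensor _
  r_comp_f := by rw [← LinearMap.lTensor_comp, E.r_comp_f, LinearMap.lTensor_id]
  g_comp_s := by rw [← LinearMap.lTensor_comp, E.g_comp_s, LinearMap.lTensor_id]
  g_comp_f := by rw [← LinearMap.lTensor_comp, E.g_comp_f, LinearMap.lTensor_zero]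
  f_comp_r_add := by
    rw [← LinearMap.lTensor_comp, ← LinearMap.lTensor_comp, ← LinearMap.lTensor_add,
      E.f_comp_r_add, LinearMap.lTensor_id]
  f_comp_d := tensor_ext₂ fun a b x => by
    have := LinearMap.congr_fun E.f_comp_d (b ⊗ₜ x)
    rw [LinearMap.comp_apply, LinearMap.comp_apply, LinearMap.lTensor_tmul] at this
    rw [LinearMap.comp_apply, LinearMap.comp_apply, LinearMap.lTensor_tmul, LinearMap.lTensor_tmul,
      next_d_tmul, next_d_tmul, map_sub, LinearMap.lTensor_tmul, LinearMap.lTensor_tmul, this]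
  g_comp_d := tensor_ext₂ fun a b x => by
    have := LinearMap.congr_fun E.g_comp_d (b ⊗ₜ x)
    rw [LinearMap.comp_apply, LinearMap.comp_apply, LinearMap.lTensor_tmul] at this
    rw [LinearMap.comp_apply, LinearMap.comp_apply, LinearMap.lTensor_tmul, LinearMap.lTensor_tmul,
      next_d_tmul, next_d_tmul, map_sub, LinearMap.lTensor_tmul, LinearMap.lTensor_tmul, this]
  f_mem j z hz := lTensor_mem_tensorGr (c := 0) E.f_mem hz
  r_mem j z hz := lTensor_mem_tensorGr (c := 0) E.r_mem hz
  g_mem j z hz := lTensor_mem_tensorGr E.g_mem hz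
  s_mem j z hz := lTensor_mem_tensorGr_of_shift E.s_mem E.gr_eq_bot hz
  gr_eq_bot q hq := tensorGr_eq_bot fun q' hq' => E.gr_eq_bot q' (hq'.trans_lt hq)
  mem_ker x hx := by
    apply E.injective
    rw [map_zero, E.f_torD]
    exact hx

theorem finrank_gr [Module.Finite K B.X] (j : ℕ) :
    Module.finrank K (B.gr j) = Module.finrank K (A.gr j) + Module.finrank K (C.gr (j + c)) := by
  have h1 : (B.gr j).comap E.f = A.gr j :=
    Submodule.ext fun x => ⟨E.mem_gr_of_f_mem, E.f_mem j x⟩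
  have h2 : (B.gr j).map E.g = C.gr (j + c) := by
    apply le_antisymm
    · rintro _ ⟨x, hx, rfl⟩
      exact E.g_mem j x hx
    · intro x hx
      exact ⟨E.s x, E.s_mem j x hx, E.g_s x⟩
  rw [finrank_eq_finrank_comap_add_finrank_map E.injective E.exact (B.gr j), h1, h2]

theorem map_boundaries (j : ℕ) : (B.boundaries j).map E.g = C.boundaries (j + c) := by
  apply le_antisymm
  · rintro _ ⟨_, ⟨z, hz, rfl⟩, rfl⟩
    exact ⟨_, E.next.g_mem j z hz, (E.g_torD z).symm⟩
  · rintro _ ⟨z, hz, rfl⟩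
    refine ⟨_, ⟨_, E.next.s_mem j z hz, rfl⟩, ?_⟩
    rw [E.g_torD]
    exact congrArg _ (E.next.g_s z)

/-- The chains of A that bound in B lie between the boundaries and the cycles of A. The lower
extreme means that the connecting map vanishes, the upper one that H(A) → H(B) vanishes; these are
the two cases treated below. -/
theorem finrank_boundaries [Module.Finite K B.X] (j : ℕ) :
    Module.finrank K (B.boundaries j) = Module.finrank K ((B.boundaries j).comap E.f) +
      Module.finrank K (C.boundaries (j + c)) := by
  rw [finrank_eq_finrank_comap_add_finrank_map E.injective E.exact, E.map_boundaries]

theorem boundaries_le_comap (j : ℕ) : A.boundaries j ≤ (B.boundaries j).comap E.f := by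
  rintro _ ⟨z, hz, rfl⟩
  exact ⟨_, E.next.f_mem j z hz, (E.f_torD z).symm⟩

theorem comap_le_cycles (hB : B.IsGood) (j : ℕ) : (B.boundaries j).comap E.f ≤ A.cycles j :=
  fun _ hx =>
    have h := hB.boundaries_le_cycles j hx
    ⟨E.mem_ker _ h.1, E.mem_gr_of_f_mem h.2⟩

/-- The dimension of the boundaries if the connecting map to the homology of `A` vanishes. -/
theorem finrank_boundaries_of_connecting (hA : A.IsGood) (hB : B.IsGood) (hC : C.IsGood) {j : ℕ}
    (h : A.homDim j = 0 ∨ C.next.homDim (j + c) = 0) :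
    Module.finrank K (B.boundaries j) =
      Module.finrank K (A.boundaries j) + Module.finrank K (C.boundaries (j + c)) := by
  have := hB.finite
  suffices (B.boundaries j).comap E.f = A.boundaries j by rw [E.finrank_boundaries, this]
  refine le_antisymm ?_ (E.boundaries_le_comap j)
  rcases h with h | h
  · exact (E.comap_le_cycles hB j).trans (hA.cycles_le_boundaries h)
  · rintro x ⟨z, hz, hzx⟩
    -- The usual zigzag: z bounds f x in B, so g z is a cycle in C, hence the boundary of some w.
    -- Subtracting the boundary of a lift of w moves z into the image of A without changing its own
    -- boundary.
    have hcyc : E.next.g z ∈ C.next.cycles (j + c) := by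
      refine ⟨?_, E.next.g_mem j z hz⟩
      change C.torD (E.g.lTensor _ z) = 0
      rw [← E.g_torD, hzx, E.g_f]
    obtain ⟨w, hw, hwz⟩ := hC.next.cycles_le_boundaries h hcyc
    set z' := z - B.next.torD (E.next.next.s w) with hz'
    have hz'gr : z' ∈ B.next.gr j :=
      sub_mem hz (hB.next.torD_mem_gr (E.next.next.s_mem j w hw))
    have hgz' : E.next.g z' = 0 := by
      rw [hz', map_sub, E.next.g_torD]
      erw [E.next.next.g_s w]
      rw [hwz, sub_self]
    obtain ⟨y, hy⟩ := (E.next.exact z').1 hgz'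
    refine ⟨y, E.next.mem_gr_of_f_mem (hy ▸ hz'gr), E.injective ?_⟩
    rw [E.f_torD, ← hzx]
    change B.torD (E.next.f y) = _
    rw [hy, hz', map_sub, hB.torD_next_torD, sub_zero]

/-- The dimension of the boundaries if the homology of `A` maps to zero. -/
theorem finrank_boundaries_of_zero (hA : A.IsGood) (hB : B.IsGood) {j : ℕ}
    (h : A.homDim j = 0 ∨ B.homDim j = 0) (hk : ∀ x ∈ A.ker, E.f x ∈ B.ker) :
    Module.finrank K (B.boundaries j) =
      Module.finrank K (A.cycles j) + Module.finrank K (C.boundaries (j + c)) := by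
  have := hB.finite
  suffices (B.boundaries j).comap E.f = A.cycles j by rw [E.finrank_boundaries, this]
  refine le_antisymm (E.comap_le_cycles hB j) ?_
  rcases h with h | h
  · exact (hA.cycles_le_boundaries h).trans (E.boundaries_le_comap j)
  · exact fun x hx => hB.cycles_le_boundaries h ⟨hk x hx.1, E.f_mem j x hx.2⟩

end SplitSES

end BarStage

/-! ### Betti numbers in short exact sequences of ideals. -/

section Stages

variable {K : Type u} [Field K] {n : ℕ}

instance finite_ideal (I : Ideal (ExtAlg K n)) : Module.Finite K I :=
  inferInstanceAs (Module.Finite K (I.restrictScalars K))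

theorem isGood_barStage (I : Ideal (ExtAlg K n)) (i : ℕ) :
    (barStage (n := n) (idealDeg I) i).IsGood := by
  induction i with
  | zero =>
    refine ⟨finite_ideal I, fun a b x => ?_, fun j z hz => ?_, fun _ => trivial⟩
    · exact mul_smul a b (show I from x)
    · suffices tensorGr (idealDeg I) j ≤
        (idealDeg I j).comap (barStage (n := n) (idealDeg I) 0).d from this hz
      apply tensorGr_le
      rintro p q rfl a ha x hx
      exact BarStage.mul_mem_exteriorPower ha hx
  | succ i ih => exact ih.next

theorem gradedBetti_eq_homDim (I : Ideal (ExtAlg K n)) (i j : ℕ) :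
    gradedBetti I i j = (barStage (n := n) (idealDeg I) i).homDim j := rfl

theorem gr_barStage_eq_bot {I : Ideal (ExtAlg K n)} {j : ℕ} (h : ∀ q ≤ j, idealDeg I q = ⊥)
    (i : ℕ) : ∀ q ≤ j, (barStage (n := n) (idealDeg I) i).gr q = ⊥ := by
  induction i with
  | zero => exact h
  | succ i ih => exact fun q hq => tensorGr_eq_bot fun q' hq' => ih q' (hq'.trans hq)

theorem gradedBetti_eq_zero_of_idealDeg {I : Ideal (ExtAlg K n)} {j : ℕ}
    (h : ∀ q ≤ j, idealDeg I q = ⊥) (i : ℕ) : gradedBetti I i j = 0 := by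
  have h1 := (isGood_barStage I i).homDim_add j
  have h2 : (barStage (n := n) (idealDeg I) i).cycles j = ⊥ := by
    rw [BarStage.cycles, gr_barStage_eq_bot h i j le_rfl, inf_bot_eq]
  rw [h2, finrank_bot] at h1
  rw [gradedBetti_eq_homDim]
  omega

theorem finrank_cycles_barStage_zero (I : Ideal (ExtAlg K n)) (j : ℕ) :
    Module.finrank K ((barStage (n := n) (idealDeg I) 0).cycles j) =
      Module.finrank K ((barStage (n := n) (idealDeg I) 0).gr j) := by
  rw [BarStage.cycles, show (barStage (n := n) (idealDeg I) 0).ker = ⊤ from rfl, top_inf_eq]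

theorem finrank_cycles_barStage_succ (I : Ideal (ExtAlg K n)) (i j : ℕ) :
    Module.finrank K ((barStage (n := n) (idealDeg I) (i + 1)).cycles j) +
        Module.finrank K ((barStage (n := n) (idealDeg I) i).boundaries j) =
      Module.finrank K ((barStage (n := n) (idealDeg I) (i + 1)).gr j) :=
  (isGood_barStage I i).finrank_cycles_next j

variable {I J L : Ideal (ExtAlg K n)} {c : ℕ}

/-- A short exact sequence of ideals induces short exact sequences of all stages. -/
def barStageSES (E : BarStage.SplitSES (barStage (n := n) (idealDeg I) 0)
      (barStage (n := n) (idealDeg J) 0) (barStage (n := n) (idealDeg L) 0) c) :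
    ∀ i, BarStage.SplitSES (barStage (n := n) (idealDeg I) i)
      (barStage (n := n) (idealDeg J) i) (barStage (n := n) (idealDeg L) i) c
  | 0 => E
  | i + 1 => (barStageSES E i).next

variable (E : BarStage.SplitSES (barStage (n := n) (idealDeg I) 0)
      (barStage (n := n) (idealDeg J) 0) (barStage (n := n) (idealDeg L) 0) c)

include E

theorem finrank_gr_barStage (i j : ℕ) :
    Module.finrank K ((barStage (n := n) (idealDeg J) i).gr j) =
      Module.finrank K ((barStage (n := n) (idealDeg I) i).gr j) +
      Module.finrank K ((barStage (n := n) (idealDeg L) i).gr (j + c)) := by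
  have := (isGood_barStage J i).finite
  exact (barStageSES E i).finrank_gr j

theorem f_mem_ker_barStage (i : ℕ) :
    ∀ x ∈ (barStage (n := n) (idealDeg I) i).ker,
      (barStageSES E i).f x ∈ (barStage (n := n) (idealDeg J) i).ker := by
  cases i with
  | zero => exact fun _ _ => trivial
  | succ i =>
    intro x hx
    have hx : (barStage (n := n) (idealDeg I) i).torD x = 0 := hx
    exact ((barStageSES E i).f_torD x).symm.trans ((congrArg _ hx).trans (map_zero _))

/-- Additivity of the Betti numbers when the connecting homomorphisms vanish. -/
theorem gradedBetti_add {j : ℕ}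
    (h : ∀ i, gradedBetti I i j = 0 ∨ gradedBetti L (i + 1) (j + c) = 0) (i : ℕ) :
    gradedBetti J i j = gradedBetti I i j + gradedBetti L i (j + c) := by
  have hb := fun i => (barStageSES E i).finrank_boundaries_of_connecting (isGood_barStage I i)
    (isGood_barStage J i) (isGood_barStage L i) (h i)
  have hI := (isGood_barStage I i).homDim_add j
  have hJ := (isGood_barStage J i).homDim_add j
  have hL := (isGood_barStage L i).homDim_add (j + c)
  have hbi := hb i
  have hg := finrank_gr_barStage E i j
  simp only [gradedBetti_eq_homDim]
  -- Betti numbers at stage i + 1 involve the boundaries at stages i and i + 1, so the vanishing is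
  -- needed at both; at stage 0 every chain is a cycle.
  cases i with
  | zero =>
    rw [finrank_cycles_barStage_zero] at hI hJ hL
    omega
  | succ i =>
    have hI' := finrank_cycles_barStage_succ I i j
    have hJ' := finrank_cycles_barStage_succ J i j
    have hL' := finrank_cycles_barStage_succ L i (j + c)
    have hbi' := hb i
    omega

/-- When Tor_0(I) → Tor_0(J) is zero in degree j, right exactness makes Tor_0(J) → Tor_0(L) an
isomorphism there. -/
theorem gradedBetti_zero_shift {j : ℕ} (h : gradedBetti I 0 j = 0 ∨ gradedBetti J 0 j = 0) :
    gradedBetti L 0 (j + c) = gradedBetti J 0 j := by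
  have hb := (barStageSES E 0).finrank_boundaries_of_zero (isGood_barStage I 0)
    (isGood_barStage J 0) h (f_mem_ker_barStage E 0)
  have hJ := (isGood_barStage J 0).homDim_add j
  have hL := (isGood_barStage L 0).homDim_add (j + c)
  have hg := finrank_gr_barStage E 0 j
  rw [finrank_cycles_barStage_zero] at hb hJ hL
  simp only [gradedBetti_eq_homDim]
  omega

/-- If the inclusion is zero on Tor_i and on Tor_{i+1}, the long exact sequence breaks up into 0 →
Tor_{i+1}(J) → Tor_{i+1}(L) → Tor_i(I) → 0. -/
theorem gradedBetti_succ_shift {i j : ℕ} (h : gradedBetti I i j = 0 ∨ gradedBetti J i j = 0)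
    (h' : gradedBetti I (i + 1) j = 0 ∨ gradedBetti J (i + 1) j = 0) :
    gradedBetti L (i + 1) (j + c) = gradedBetti J (i + 1) j + gradedBetti I i j := by
  have hb := (barStageSES E i).finrank_boundaries_of_zero (isGood_barStage I i)
    (isGood_barStage J i) h (f_mem_ker_barStage E i)
  have hb' := (barStageSES E (i + 1)).finrank_boundaries_of_zero (isGood_barStage I (i + 1))
    (isGood_barStage J (i + 1)) h' (f_mem_ker_barStage E (i + 1))
  have hI := (isGood_barStage I i).homDim_add j
  have hJ := (isGood_barStage J (i + 1)).homDim_add j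
  have hL := (isGood_barStage L (i + 1)).homDim_add (j + c)
  have hg := finrank_gr_barStage E (i + 1) j
  have hI' := finrank_cycles_barStage_succ I i j
  have hJ' := finrank_cycles_barStage_succ J i j
  have hL' := finrank_cycles_barStage_succ L i (j + c)
  simp only [gradedBetti_eq_homDim]
  omega

end Stages

/-! ### Short exact sequences of monomial ideals. -/

section MonomialSequences

variable {K : Type u} [Field K] {n : ℕ}

/-- The restriction of a `K`-linear endomorphism of `E` to ideals. -/
def restrictIdeal (φ : ExtAlg K n →ₗ[K] ExtAlg K n) {I J : Ideal (ExtAlg K n)}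
    (h : ∀ x ∈ I, φ x ∈ J) : I →ₗ[K] J where
  toFun x := ⟨φ x, h x x.2⟩
  map_add' _ _ := Subtype.ext (map_add φ _ _)
  map_smul' a x := Subtype.ext (map_smul φ a (x : ExtAlg K n))

theorem map_mem_monoIdeal {A B : Set (Finset (Fin n))} {φ : ExtAlg K n →ₗ[K] ExtAlg K n}
    (h : ∀ ν ∈ multiples A, φ (mono K ν) ∈ monoIdeal K B) :
    ∀ x ∈ monoIdeal K A, φ x ∈ monoIdeal K B := by
  intro x hx
  rw [mem_monoIdeal_iff] at hx
  suffices Submodule.span K (mono K '' multiples A) ≤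
      ((monoIdeal K B).restrictScalars K).comap φ from this hx
  rw [Submodule.span_le]
  rintro _ ⟨ν, hν, rfl⟩
  exact h ν hν

theorem eq_of_mem_monoIdeal {A : Set (Finset (Fin n))} {φ ψ : ExtAlg K n →ₗ[K] ExtAlg K n}
    (h : ∀ ν ∈ multiples A, φ (mono K ν) = ψ (mono K ν)) :
    ∀ x ∈ monoIdeal K A, φ x = ψ x := by
  intro x hx
  rw [mem_monoIdeal_iff] at hx
  refine LinearMap.eqOn_span ?_ hx
  rintro _ ⟨ν, hν, rfl⟩
  exact h ν hν

theorem map_mem_exteriorPower {i j : ℕ} {φ : ExtAlg K n →ₗ[K] ExtAlg K n}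
    (h : ∀ ν : Finset (Fin n), ν.card = i → φ (mono K ν) ∈ ⋀[K]^j (Fin n → K)) :
    ∀ x ∈ ⋀[K]^i (Fin n → K), φ x ∈ ⋀[K]^j (Fin n → K) := by
  intro x hx
  rw [exteriorPower_eq_span] at hx
  suffices Submodule.span K (mono K '' {μ | μ.card = i}) ≤
      (⋀[K]^j (Fin n → K)).comap φ from this hx
  rw [Submodule.span_le]
  rintro _ ⟨ν, hν, rfl⟩
  exact h ν hν

open Classical in
variable (K) in
/-- The projection of `E` onto the span of the monomials with support in `U`. -/
def monoProj (U : Set (Finset (Fin n))) : ExtAlg K n →ₗ[K] ExtAlg K n :=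
  (Pi.basisFun K (Fin n)).ExteriorAlgebra.constr K fun ν => if ν ∈ U then mono K ν else 0

open Classical in
theorem monoProj_mono (U : Set (Finset (Fin n))) (ν : Finset (Fin n)) :
    monoProj K U (mono K ν) = if ν ∈ U then mono K ν else 0 :=
  Module.Basis.constr_basis _ _ _ _

variable (K) in
-- Division by e_τ on the right, sending e_ν to ±e_{ν∖τ}. The sign is pinned down only by the
-- requirement that multiplying back gives e_ν. The map is K-linear, which is all a splitting has to
-- be.
theorem exists_section_mulRight_mono (τ : Finset (Fin n)) :
    ∃ φ : ExtAlg K n →ₗ[K] ExtAlg K n, ∀ ν,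
      (τ ⊆ ν → (∃ a : K, φ (mono K ν) = a • mono K (ν \ τ)) ∧ φ (mono K ν) * mono K τ = mono K ν) ∧
      (¬τ ⊆ ν → φ (mono K ν) = 0) := by
  classical
  have h : ∀ ν : Finset (Fin n), ∃ y : ExtAlg K n,
      (τ ⊆ ν → (∃ a : K, y = a • mono K (ν \ τ)) ∧ y * mono K τ = mono K ν) ∧
      (¬τ ⊆ ν → y = 0) := by
    intro ν
    by_cases hν : τ ⊆ ν
    · obtain ⟨c, hc, h⟩ := exists_mono_mul_of_disjoint K (Finset.sdiff_disjoint (s := τ) (t := ν))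
      rw [Finset.sdiff_union_of_subset hν] at h
      refine ⟨c⁻¹ • mono K (ν \ τ), fun _ => ⟨⟨c⁻¹, rfl⟩, ?_⟩, fun h => absurd hν h⟩
      rw [smul_mul_assoc, h, inv_smul_smul₀ hc]
    · exact ⟨0, fun h => absurd h hν, fun _ => rfl⟩
  choose y hy using h
  refine ⟨(Pi.basisFun K (Fin n)).ExteriorAlgebra.constr K y, fun ν => ?_⟩
  have : (Pi.basisFun K (Fin n)).ExteriorAlgebra.constr K y (mono K ν) = y ν :=
    Module.Basis.constr_basis _ _ _ _
  rw [this]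
  exact hy ν

/-- The short exact sequence `0 → I_A → I_B → I_C(|τ|) → 0` of monomial ideals whose second map is
the right multiplication by `e_τ`. -/
theorem nonempty_monoIdealSES {A B C : Set (Finset (Fin n))} {τ : Finset (Fin n)}
    (hAB : multiples A ⊆ multiples B) (hA : ∀ ν ∈ multiples A, ¬Disjoint ν τ)
    (hB : ∀ ν ∈ multiples B, ν ∉ multiples A → Disjoint ν τ ∧ ν ∪ τ ∈ multiples C)
    (hC : ∀ ν ∈ multiples C, τ ⊆ ν ∧ ν \ τ ∈ multiples B ∧ ν \ τ ∉ multiples A) :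
    Nonempty (BarStage.SplitSES (barStage (n := n) (idealDeg (monoIdeal K A)) 0)
      (barStage (n := n) (idealDeg (monoIdeal K B)) 0)
      (barStage (n := n) (idealDeg (monoIdeal K C)) 0) τ.card) := by
  classical
  obtain ⟨φ, hφ⟩ := exists_section_mulRight_mono K τ
  have mem : ∀ {D : Set (Finset (Fin n))} {ν}, ν ∈ multiples D → mono K ν ∈ monoIdeal K D :=
    fun h => (mono_mem_monoIdeal K).2 h
  have hf : ∀ x ∈ monoIdeal K A, LinearMap.id (R := K) x ∈ monoIdeal K B :=
    map_mem_monoIdeal fun ν hν => mem (hAB hν)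
  have hr : ∀ x ∈ monoIdeal K B, monoProj K (multiples A) x ∈ monoIdeal K A := by
    refine map_mem_monoIdeal fun ν hν => ?_
    rw [monoProj_mono]
    split_ifs with h
    · exact mem h
    · exact zero_mem _
  have hg : ∀ x ∈ monoIdeal K B, LinearMap.mulRight K (mono K τ) x ∈ monoIdeal K C := by
    refine map_mem_monoIdeal fun ν hν => ?_
    rw [LinearMap.mulRight_apply]
    by_cases h : ν ∈ multiples A
    · rw [mono_mul_of_not_disjoint K (hA ν h)]
      exact zero_mem _
    · obtain ⟨h1, h2⟩ := hB ν hν h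
      obtain ⟨a, -, ha⟩ := exists_mono_mul_of_disjoint K h1
      rw [ha]
      exact ((monoIdeal K C).restrictScalars K).smul_mem a (mem h2)
  have hs : ∀ x ∈ monoIdeal K C, φ x ∈ monoIdeal K B := by
    refine map_mem_monoIdeal fun ν hν => ?_
    obtain ⟨h1, h2, -⟩ := hC ν hν
    obtain ⟨⟨a, ha⟩, -⟩ := (hφ ν).1 h1
    rw [ha]
    exact ((monoIdeal K B).restrictScalars K).smul_mem a (mem h2)
  have hgs : ∀ x ∈ monoIdeal K C, φ x * mono K τ = x :=
    eq_of_mem_monoIdeal (φ := LinearMap.mulRight K (mono K τ) ∘ₗ φ) (ψ := LinearMap.id)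
      fun ν hν => ((hφ ν).1 (hC ν hν).1).2
  refine ⟨
    { f := restrictIdeal LinearMap.id hf
      r := restrictIdeal (monoProj K (multiples A)) hr
      g := restrictIdeal (LinearMap.mulRight K (mono K τ)) hg
      s := restrictIdeal φ hs
      r_comp_f := ?_
      g_comp_s := ?_
      g_comp_f := ?_
      f_comp_r_add := ?_
      f_comp_d := ?_
      g_comp_d := ?_
      f_mem := fun j x hx => hx
      r_mem := fun j x hx => ?_
      g_mem := fun j x hx => ?_
      s_mem := fun j x hx => ?_
      gr_eq_bot := fun q hq => ?_
      mem_ker := fun _ _ => trivial }⟩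
  · refine LinearMap.ext fun x => Subtype.ext ?_
    refine eq_of_mem_monoIdeal (φ := monoProj K (multiples A)) (ψ := LinearMap.id)
      (fun ν hν => ?_) _ x.2
    rw [monoProj_mono, if_pos hν]
    rfl
  · exact LinearMap.ext fun x => Subtype.ext (hgs _ x.2)
  · refine LinearMap.ext fun x => Subtype.ext ?_
    exact eq_of_mem_monoIdeal (φ := LinearMap.mulRight K (mono K τ)) (ψ := 0)
      (fun ν hν => mono_mul_of_not_disjoint K (hA ν hν)) _ x.2
  · refine LinearMap.ext fun x => Subtype.ext ?_
    refine eq_of_mem_monoIdeal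
      (φ := monoProj K (multiples A) + φ ∘ₗ LinearMap.mulRight K (mono K τ)) (ψ := LinearMap.id)
      (fun ν hν => ?_) _ x.2
    rw [LinearMap.add_apply, LinearMap.comp_apply, LinearMap.mulRight_apply, monoProj_mono,
      LinearMap.id_apply]
    split_ifs with h
    · rw [mono_mul_of_not_disjoint K (hA ν h), map_zero, add_zero]
    · obtain ⟨h1, h2⟩ := hB ν hν h
      obtain ⟨a, ha0, ha⟩ := exists_mono_mul_of_disjoint K h1
      obtain ⟨⟨b, hb⟩, hb'⟩ := (hφ (ν ∪ τ)).1 Finset.subset_union_right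
      rw [Finset.union_sdiff_cancel_right h1] at hb
      rw [hb, smul_mul_assoc, ha, smul_smul] at hb'
      have hne : mono K (ν ∪ τ) ≠ 0 := (Pi.basisFun K (Fin n)).ExteriorAlgebra.ne_zero _
      -- The signs of dividing and of multiplying by e_τ cancel, as comparing coefficients of e_{ν ∪
      -- τ} shows.
      have hab : b * a = 1 := by
        have : (b * a - 1) • mono K (ν ∪ τ) = 0 := by rw [sub_smul, hb', one_smul, sub_self]
        exact sub_eq_zero.1 ((smul_eq_zero.1 this).resolve_right hne)
      rw [ha, map_smul, hb, smul_smul, mul_comm, hab, one_smul, zero_add]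
  · refine TensorProduct.ext' fun a x => ?_
    exact Subtype.ext rfl
  · refine TensorProduct.ext' fun a x => ?_
    -- Right multiplication respects the left module structure by associativity.
    exact Subtype.ext (mul_assoc a (show monoIdeal K B from x).1 (mono K τ))
  · refine map_mem_exteriorPower (φ := monoProj K (multiples A)) (fun ν hν => ?_) _ hx
    rw [monoProj_mono]
    split_ifs
    · exact hν ▸ mono_mem_exteriorPower K ν
    · exact zero_mem _
  · exact BarStage.mul_mem_exteriorPower hx (mono_mem_exteriorPower K τ)
  · refine map_mem_exteriorPower (i := j + τ.card) (φ := φ) (fun ν hν => ?_) _ hx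
    by_cases h : τ ⊆ ν
    · obtain ⟨⟨a, ha⟩, -⟩ := (hφ ν).1 h
      rw [ha]
      refine Submodule.smul_mem _ _ ?_
      have h2 := mono_mem_exteriorPower K (ν \ τ)
      rwa [Finset.card_sdiff_of_subset h, hν, Nat.add_sub_cancel] at h2
    · rw [(hφ ν).2 h]
      exact zero_mem _
  -- Below degree |τ| no monomial is divisible by e_τ, so φ kills x; but φ(x) e_τ = x on I_C.
  · rw [eq_bot_iff]
    intro x hx
    rw [Submodule.mem_bot]
    refine Subtype.ext ?_
    have hx' : (x : monoIdeal K C).1 ∈ ⋀[K]^q (Fin n → K) := hx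
    have h0 : φ (x : monoIdeal K C).1 = 0 := by
      rw [exteriorPower_eq_span] at hx'
      refine LinearMap.eqOn_span (g := 0) ?_ hx'
      rintro _ ⟨ν, hν, rfl⟩
      refine (hφ ν).2 fun h => ?_
      have := Finset.card_le_card h
      simp only [Set.mem_ofPred_eq] at hν
      omega
    have h1 := hgs _ (x : monoIdeal K C).2
    rw [h0, zero_mul] at h1
    exact h1.symm

end MonomialSequences

/-! ### Contracting the bar complex of a free module of rank one. -/

namespace BarStage

variable {K : Type u} [Field K] {n : ℕ}

/-- A homotopy which contracts the complex from the stage `S` on. -/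
structure Contraction (S : BarStage K n) where
  h : S.X →ₗ[K] ExtAlg K n ⊗[K] S.X
  ε : K
  ε_ne_zero : ε ≠ 0
  h_mem : ∀ j, ∀ x ∈ S.gr j, h x ∈ tensorGr S.gr j
  d_h : ∀ z, S.next.d (h.lTensor _ z) = h (S.d z) - ε • z

variable {S : BarStage K n}

/-- The contraction that is induced on the next stage. -/
def Contraction.next (H : S.Contraction) : S.next.Contraction where
  h := H.h.lTensor _
  -- The term -a ⊗ d(…) in the next differential reverses the sign of the homotopy identity.
  ε := -H.ε
  ε_ne_zero := neg_ne_zero.2 H.ε_ne_zero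
  h_mem j z hz := lTensor_mem_tensorGr (c := 0) H.h_mem hz
  d_h := by
    suffices S.next.next.d ∘ₗ (H.h.lTensor _).lTensor _ =
        H.h.lTensor _ ∘ₗ S.next.d - (-H.ε) • LinearMap.id from LinearMap.congr_fun this
    refine tensor_ext₂ fun a b x => ?_
    have hd := H.d_h (b ⊗ₜ x)
    rw [LinearMap.lTensor_tmul] at hd
    rw [LinearMap.sub_apply, LinearMap.comp_apply, LinearMap.comp_apply, LinearMap.lTensor_tmul,
      LinearMap.lTensor_tmul, next_d_tmul, next_d_tmul, hd, map_sub, LinearMap.lTensor_tmul,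
      LinearMap.lTensor_tmul, TensorProduct.tmul_sub, LinearMap.smul_apply, LinearMap.id_apply,
      TensorProduct.tmul_smul, neg_smul]
    abel

theorem Contraction.homDim_next (H : S.Contraction) (hS : S.IsGood) (j : ℕ) :
    S.next.homDim j = 0 := by
  have hle : S.next.cycles j ≤ S.next.boundaries j := by
    rintro z ⟨hz, hzj⟩
    -- The augmentation commutes with h, so torD(h z) = h(torD z) + ε z; for a cycle z this is ε z.
    refine ⟨H.ε⁻¹ • H.h.lTensor _ z, Submodule.smul_mem _ _ (H.next.h_mem j z hzj), ?_⟩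
    have hz0 : S.torD z = 0 := hz
    rw [map_smul, torD_apply, H.d_h]
    erw [augMap_lTensor H.h z]
    rw [sub_sub_eq_add_sub, add_sub_right_comm, ← map_sub, ← torD_apply, hz0, map_zero, zero_add,
      inv_smul_smul₀ H.ε_ne_zero]
  have h1 := hS.next.homDim_add j
  have h2 : S.next.boundaries j = S.next.cycles j :=
    le_antisymm (hS.next.boundaries_le_cycles j) hle
  rw [h2] at h1
  omega

/-- A stage which is, as an `E`-module, the algebra `E` itself: `φ` is an isomorphism to `E` and
`x₀` is the preimage of `1`. -/
structure UnitModule (S : BarStage K n) where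
  φ : S.X →ₗ[K] ExtAlg K n
  x₀ : S.X
  d_tmul_unit : ∀ x, S.d (φ x ⊗ₜ x₀) = x
  φ_d : ∀ a x, φ (S.d (a ⊗ₜ x)) = a * φ x
  φ_mem : ∀ j, ∀ x ∈ S.gr j, φ x ∈ ⋀[K]^j (Fin n → K)
  unit_mem : x₀ ∈ S.gr 0

/-- The contraction `x ↦ x ⊗ 1` of the bar construction for the module `E`. -/
def UnitModule.contraction (U : S.UnitModule) : S.Contraction where
  h := (TensorProduct.mk K (ExtAlg K n) S.X).flip U.x₀ ∘ₗ U.φ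
  ε := 1
  ε_ne_zero := one_ne_zero
  h_mem j x hx := tmul_mem_tensorGr (q := 0) (U.φ_mem j x hx) U.unit_mem
  d_h := by
    set h := (TensorProduct.mk K (ExtAlg K n) S.X).flip U.x₀ ∘ₗ U.φ with hh
    suffices S.next.d ∘ₗ h.lTensor _ = h ∘ₗ S.d - (1 : K) • LinearMap.id from
      LinearMap.congr_fun this
    refine TensorProduct.ext' fun a x => ?_
    rw [LinearMap.sub_apply, LinearMap.comp_apply, LinearMap.comp_apply, LinearMap.lTensor_tmul,
      hh, LinearMap.comp_apply, LinearMap.comp_apply, LinearMap.flip_apply, LinearMap.flip_apply,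
      TensorProduct.mk_apply, TensorProduct.mk_apply, next_d_tmul, U.d_tmul_unit, U.φ_d,
      LinearMap.smul_apply, LinearMap.id_apply, one_smul]

theorem UnitModule.gr_le_boundaries (U : S.UnitModule) {j : ℕ} (hj : j ≠ 0) :
    S.gr j ≤ S.boundaries j := by
  intro x hx
  refine ⟨-(U.φ x ⊗ₜ U.x₀),
    neg_mem (tmul_mem_tensorGr (q := 0) (U.φ_mem j x hx) U.unit_mem), ?_⟩
  rw [map_neg, torD_apply, augMap_tmul, U.d_tmul_unit,
    algebraMapInv_of_mem_exteriorPower hj (U.φ_mem j x hx), zero_smul, zero_sub, neg_neg]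

end BarStage

/-! ### Betti numbers of principal monomial ideals. -/

section PrincipalIdeals

variable (K : Type u) [Field K] {n : ℕ}

theorem one_mem_monoIdeal_empty : (1 : ExtAlg K n) ∈ monoIdeal K {∅} := by
  rw [← mono_empty K]
  exact Ideal.subset_span ⟨∅, rfl, rfl⟩

theorem one_mem_exteriorPower_zero : (1 : ExtAlg K n) ∈ ⋀[K]^0 (Fin n → K) := by
  rw [← mono_empty K]
  exact mono_mem_exteriorPower K ∅

theorem exists_eq_algebraMap_of_mem_exteriorPower_zero {a : ExtAlg K n}
    (ha : a ∈ ⋀[K]^0 (Fin n → K)) : ∃ c : K, a = algebraMap K _ c := by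
  rw [ExteriorAlgebra.exteriorPower, pow_zero, Submodule.mem_one] at ha
  obtain ⟨c, rfl⟩ := ha
  exact ⟨c, rfl⟩

variable (n) in
/-- The unit of `E` as an element of the unit ideal. -/
def unitElem : monoIdeal K ({∅} : Set (Finset (Fin n))) := ⟨1, one_mem_monoIdeal_empty K⟩

variable (n) in
/-- The unit ideal as the module `E`. -/
def unitModule :
    (barStage (n := n) (idealDeg (monoIdeal K ({∅} : Set (Finset (Fin n))))) 0).UnitModule where
  φ := (monoIdeal K {∅}).subtype.restrictScalars K
  x₀ := unitElem K n
  d_tmul_unit x := Subtype.ext (mul_one (show monoIdeal K {∅} from x).1)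
  φ_d _ _ := rfl
  φ_mem _ _ hx := hx
  unit_mem := one_mem_exteriorPower_zero K

variable (n) in
/-- The contraction of the bar construction for the module `E`, from the stage `i` on. -/
def unitContraction : ∀ i,
    (barStage (n := n) (idealDeg (monoIdeal K ({∅} : Set (Finset (Fin n))))) i).Contraction
  | 0 => (unitModule K n).contraction
  | i + 1 => (unitContraction i).next

/-- E is free on a generator of degree 0. Truncated subtraction gives `(i - 1).choose i` the value 1
at i = 0 and 0 for i > 0, which is the convention for an empty set. -/
theorem gradedBetti_monoIdeal_empty (i j : ℕ) :
    gradedBetti (monoIdeal K ({∅} : Set (Finset (Fin n)))) i j =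
      if j = i then (i - 1).choose i else 0 := by
  set I := monoIdeal K ({∅} : Set (Finset (Fin n))) with hI
  cases i with
  | succ i =>
    rw [Nat.choose_eq_zero_of_lt (by omega), ite_self]
    exact (unitContraction K n i).homDim_next (isGood_barStage I i) j
  | zero =>
    have h := (isGood_barStage I 0).homDim_add j
    rw [finrank_cycles_barStage_zero, ← gradedBetti_eq_homDim] at h
    rcases Nat.eq_zero_or_pos j with rfl | hj
    · have h0 : (barStage (n := n) (idealDeg I) 0).boundaries 0 = ⊥ := by
        rw [eq_bot_iff, Submodule.map_le_iff_le_comap]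
        apply tensorGr_le
        intro p q hpq a ha x _
        obtain rfl : p = 0 := by omega
        obtain ⟨c, rfl⟩ := exists_eq_algebraMap_of_mem_exteriorPower_zero K ha
        rw [Submodule.mem_comap, Submodule.mem_bot, BarStage.torD_apply, augMap_tmul,
          ExteriorAlgebra.algebraMap_leftInverse, sub_eq_zero]
        exact Subtype.ext (Algebra.smul_def c (show I from x).1)
      have h1 : Module.finrank K ((barStage (n := n) (idealDeg I) 0).gr 0) = 1 := by
        refine finrank_eq_one (⟨unitElem K n, one_mem_exteriorPower_zero K⟩ :
          (barStage (n := n) (idealDeg I) 0).gr 0) ?_ ?_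
        · intro h
          have h2 : (unitElem K n).1 = (0 : ExtAlg K n) :=
            congrArg (fun x => (show I from x.1).1) h
          exact one_ne_zero h2
        · rintro ⟨x, hx⟩
          obtain ⟨c, hc⟩ := exists_eq_algebraMap_of_mem_exteriorPower_zero K hx
          refine ⟨c, Subtype.ext (Subtype.ext ?_)⟩
          exact (Algebra.algebraMap_eq_smul_one c).symm.trans hc.symm
      rw [h0, h1, finrank_bot] at h
      simpa using h
    · have := (isGood_barStage I 0).finite
      have h1 : Module.finrank K ((barStage (n := n) (idealDeg I) 0).gr j) ≤
          Module.finrank K ((barStage (n := n) (idealDeg I) 0).boundaries j) :=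
        Submodule.finrank_mono ((unitModule K n).gr_le_boundaries hj.ne')
      rw [if_neg hj.ne']
      omega

theorem multiples_singleton (S : Finset (Fin n)) : multiples {S} = {ν | S ⊆ ν} := by
  ext ν
  simp [multiples]

theorem idealDeg_zero_eq_bot {S : Finset (Fin n)} (hS : S.Nonempty) :
    idealDeg (monoIdeal K {S}) 0 = ⊥ := by
  rw [eq_bot_iff]
  intro x hx
  obtain ⟨c, hc⟩ := exists_eq_algebraMap_of_mem_exteriorPower_zero K hx
  replace hc : (x : ExtAlg K n) = algebraMap K _ c := hc
  have h1 := x.2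
  rw [hc] at h1
  by_cases h0 : c = 0
  · rw [Submodule.mem_bot]
    exact Subtype.ext (by rw [hc, h0, map_zero]; rfl)
  · have h2 := (monoIdeal K {S}).mul_mem_left (algebraMap K _ c⁻¹) h1
    rw [← map_mul, inv_mul_cancel₀ h0, map_one, ← mono_empty K, mono_mem_monoIdeal] at h2
    obtain ⟨μ, rfl, hμ⟩ := h2
    exact absurd (Finset.subset_empty.1 hμ) hS.ne_empty

/-- The graded Betti numbers of the principal ideal `(e_S)`. -/
theorem gradedBetti_monoIdeal_singleton (S : Finset (Fin n)) : ∀ i j,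
    gradedBetti (monoIdeal K {S}) i j =
      if j = i + S.card then (i + S.card - 1).choose i else 0 := by
  induction S using Finset.induction_on with
  | empty => exact gradedBetti_monoIdeal_empty K
  | insert l S hl ih =>
    have hE := nonempty_monoIdealSES (K := K) (A := {insert l S}) (B := {S}) (C := {insert l S})
      (τ := {l})
      (by
        rw [multiples_singleton, multiples_singleton]
        exact fun ν h => (Finset.subset_insert l S).trans h)
      (by
        rw [multiples_singleton]
        intro ν h
        rw [Finset.disjoint_singleton_right, not_not]
        exact h (Finset.mem_insert_self l S))
      (by
        rw [multiples_singleton, multiples_singleton]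
        intro ν (h : S ⊆ ν) (h' : ¬insert l S ⊆ ν)
        rw [Finset.insert_subset_iff, not_and_or] at h'
        refine ⟨Finset.disjoint_singleton_right.2 (h'.resolve_right (not_not.2 h)), ?_⟩
        change insert l S ⊆ ν ∪ {l}
        rw [Finset.insert_subset_iff]
        exact ⟨by simp, h.trans Finset.subset_union_left⟩)
      (by
        rw [multiples_singleton, multiples_singleton]
        intro ν (h : insert l S ⊆ ν)
        rw [Finset.insert_subset_iff] at h
        refine ⟨by simpa using h.1, ?_, ?_⟩
        · change S ⊆ ν \ {l}
          rw [Finset.subset_sdiff, Finset.disjoint_singleton_right]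
          exact ⟨h.2, hl⟩
        · intro (h' : insert l S ⊆ ν \ {l})
          have := h' (Finset.mem_insert_self l S)
          simp at this)
    obtain ⟨E⟩ := hE
    rw [Finset.card_insert_of_notMem hl]
    have h0 : ∀ i, gradedBetti (monoIdeal K {insert l S}) i 0 = 0 := fun i =>
      gradedBetti_eq_zero_of_idealDeg (fun q hq => by
        rw [Nat.le_zero.1 hq]
        exact idealDeg_zero_eq_bot K (Finset.insert_nonempty l S)) i
    -- The ideal (e_{insert l S}) is both the submodule and the shifted quotient, so its Betti
    -- number in degree j + 1 is computed from those in degree j. Hence the inner induction on j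
    -- inside the one on i.
    intro i
    induction i with
    | zero =>
      intro j
      induction j with
      | zero => rw [h0, if_neg (by omega)]
      | succ j ihj =>
        have := gradedBetti_zero_shift E (j := j) (by
          rw [ihj, ih]
          split_ifs <;> omega)
        rw [Finset.card_singleton] at this
        rw [this, ih]
        simp only [Nat.choose_zero_right]
        split_ifs <;> omega
    | succ i ihi =>
      intro j
      induction j with
      | zero => rw [h0, if_neg (by omega)]
      | succ j ihj =>
        have := gradedBetti_succ_shift E (i := i) (j := j)
          (by
            rw [ihi, ih]
            split_ifs <;> omega)
          (by
            rw [ihj, ih]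
            split_ifs <;> omega)
        rw [Finset.card_singleton] at this
        rw [this, ih, ihi]
        -- In the only degree that contributes, the sum is Pascal's rule.
        by_cases hj : j = i + 1 + S.card
        · rw [if_pos hj, if_pos (by omega), if_pos (by omega),
            show i + 1 + (S.card + 1) - 1 = (i + S.card) + 1 by omega,
            show i + 1 + S.card - 1 = i + S.card by omega,
            show i + (S.card + 1) - 1 = i + S.card by omega, Nat.choose_succ_succ, add_comm]
        · rw [if_neg hj, if_neg (by omega), if_neg (by omega)]

end PrincipalIdeals

/-! ### Colon ideals and the induction over the generators. -/

section LinearQuotientSteps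

variable {K : Type u} [Field K] {n : ℕ}

theorem multiples_union (A B : Set (Finset (Fin n))) :
    multiples (A ∪ B) = multiples A ∪ multiples B := by
  ext ν
  simp only [multiples, Set.mem_union, Set.mem_ofPred_eq, or_and_right, exists_or]

theorem mem_multiples_of_subset {A : Set (Finset (Fin n))} {μ ν : Finset (Fin n)}
    (hμ : μ ∈ multiples A) (h : μ ⊆ ν) : ν ∈ multiples A :=
  let ⟨σ, hσ, hσμ⟩ := hμ
  ⟨σ, hσ, hσμ.trans h⟩

/-- Adding a generator `e_μ` whose colon ideal is generated by the variables in `S`. -/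
theorem nonempty_colonSES (A : Set (Finset (Fin n))) {μ S : Finset (Fin n)} (hμS : μ ⊆ S)
    (h : ∀ ν, μ ⊆ ν → (ν ∈ multiples A ↔ ¬Disjoint ν (S \ μ))) :
    Nonempty (BarStage.SplitSES (barStage (n := n) (idealDeg (monoIdeal K A)) 0)
      (barStage (n := n) (idealDeg (monoIdeal K (A ∪ {μ}))) 0)
      (barStage (n := n) (idealDeg (monoIdeal K {S})) 0) (S \ μ).card) := by
  -- Here τ = S \ μ, and right multiplication by e_τ takes e_μ to ±e_S.
  apply nonempty_monoIdealSES
  · rw [multiples_union]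
    exact Set.subset_union_left
  · intro ν hν hd
    -- The hypothesis concerns multiples of e_μ only, so ν is enlarged by μ, which is disjoint from
    -- S \ μ.
    refine (h (ν ∪ μ) Finset.subset_union_right).1
      (mem_multiples_of_subset hν Finset.subset_union_left) ?_
    rw [Finset.disjoint_union_left]
    exact ⟨hd, Finset.disjoint_sdiff⟩
  · rw [multiples_union, multiples_singleton, multiples_singleton]
    rintro ν (hν | hν) hνA
    · exact absurd hν hνA
    · refine ⟨not_not.1 fun hd => hνA ((h ν hν).2 hd), ?_⟩
      change S ⊆ ν ∪ (S \ μ)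
      rw [← Finset.sdiff_union_of_subset hμS, Finset.union_comm ν]
      exact Finset.union_subset_union (by simp [Finset.union_sdiff_distrib]) hν
  · rw [multiples_union, multiples_singleton, multiples_singleton]
    intro ν (hν : S ⊆ ν)
    have h1 : μ ⊆ ν \ (S \ μ) := by
      rw [Finset.subset_sdiff]
      exact ⟨hμS.trans hν, Finset.disjoint_sdiff⟩
    exact ⟨Finset.sdiff_subset.trans hν, Or.inr h1, fun h2 =>
      (h _ h1).1 h2 Finset.sdiff_disjoint⟩

theorem exists_mul_mono_eq_mono_mul (μ : Finset (Fin n)) (x : ExtAlg K n) :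
    ∃ y : ExtAlg K n, x * mono K μ = mono K μ * y := by
  induction mem_span_range_mono K x using Submodule.span_induction with
  | mem x hx =>
    obtain ⟨ν, rfl⟩ := hx
    by_cases h : Disjoint ν μ
    · obtain ⟨a, -, ha⟩ := exists_mono_mul_of_disjoint K h
      obtain ⟨b, hb0, hb⟩ := exists_mono_mul_of_disjoint K h.symm
      refine ⟨(a * b⁻¹) • mono K ν, ?_⟩
      rw [ha, mul_smul_comm, hb, smul_smul, inv_mul_cancel_right₀ hb0, Finset.union_comm]
    · exact ⟨0, by rw [mono_mul_of_not_disjoint K h, mul_zero]⟩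
  | zero => exact ⟨0, by simp⟩
  | add x y _ _ hx hy =>
    obtain ⟨x', hx⟩ := hx
    obtain ⟨y', hy⟩ := hy
    exact ⟨x' + y', by rw [add_mul, mul_add, hx, hy]⟩
  | smul a x _ hx =>
    obtain ⟨x', hx⟩ := hx
    exact ⟨a • x', by rw [smul_mul_assoc, mul_smul_comm, hx]⟩

theorem mul_mem_monoIdeal_right {A : Set (Finset (Fin n))} {x : ExtAlg K n}
    (hx : x ∈ monoIdeal K A) (y : ExtAlg K n) : x * y ∈ monoIdeal K A := by
  induction mem_span_range_mono K y using Submodule.span_induction with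
  | mem y hy => obtain ⟨μ, rfl⟩ := hy; exact mul_mono_mem_monoIdeal K hx μ
  | zero => simp
  | add y z _ _ hy hz => rw [mul_add]; exact add_mem hy hz
  | smul a y _ hy =>
    rw [mul_smul_comm]
    exact ((monoIdeal K A).restrictScalars K).smul_mem a hy

/-- The colon is tested against all a e_μ. Since e_μ commutes with monomials up to sign, a e_μ = e_μ
y for some y, and monomial ideals absorb y on the right. -/
theorem mem_colon_monoIdeal {A : Set (Finset (Fin n))} {μ : Finset (Fin n)} {x : ExtAlg K n} :
    x ∈ (monoIdeal K A).colon (Ideal.span {mono K μ} : Set (ExtAlg K n)) ↔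
      x * mono K μ ∈ monoIdeal K A := by
  rw [Submodule.mem_colon]
  constructor
  · intro h
    exact h _ (Ideal.subset_span rfl)
  · intro h s hs
    obtain ⟨a, rfl⟩ := Ideal.mem_span_singleton'.1 hs
    obtain ⟨y, hy⟩ := exists_mul_mono_eq_mono_mul μ a
    rw [smul_eq_mul, hy, ← mul_assoc]
    exact mul_mem_monoIdeal_right h y

theorem mono_mul_mono_mem_monoIdeal {A : Set (Finset (Fin n))} {μ ν : Finset (Fin n)} :
    mono K ν * mono K μ ∈ monoIdeal K A ↔ (Disjoint ν μ → ν ∪ μ ∈ multiples A) := by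
  by_cases h : Disjoint ν μ
  · obtain ⟨a, ha0, ha⟩ := exists_mono_mul_of_disjoint K h
    have h1 : mono K ν * mono K μ ∈ monoIdeal K A ↔ mono K (ν ∪ μ) ∈ monoIdeal K A := by
      rw [ha]
      exact ((monoIdeal K A).restrictScalars K).smul_mem_iff ha0
    rw [h1, mono_mem_monoIdeal]
    exact ⟨fun h2 _ => h2, fun h2 => h2 h⟩
  · rw [mono_mul_of_not_disjoint K h]
    exact ⟨fun _ h2 => absurd h2 h, fun _ => zero_mem _⟩

theorem span_var_eq_monoIdeal (S : Set (Fin n)) :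
    Ideal.span (var K '' S) = monoIdeal K ((fun k => {k}) '' S) := by
  rw [monoIdeal, Set.image_image]
  congr 1
  exact Set.image_congr fun k _ => var_eq_mono K k

variable {r : ℕ} {u : Fin r → Finset (Fin n)}

/-- For k in the support of u_j the condition is vacuous, since e_k u_j = 0; thus set(u_j) contains
that support. -/
theorem mem_qset {j : Fin r} {k : Fin n} :
    k ∈ qset K u j ↔ (k ∉ u j → insert k (u j) ∈ multiples (u '' Set.Iio j)) := by
  rw [qset, Set.mem_ofPred_eq, colonIdeal, mem_colon_monoIdeal, var_eq_mono,
    mono_mul_mono_mem_monoIdeal, Finset.disjoint_singleton_left, ← Finset.insert_eq]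

/-- This is linear quotients in combinatorial form. If e_ν is in the earlier ideal, the cofactor
e_{ν∖u_j} is in the colon ideal, so one of the generating variables divides it. -/
theorem mem_multiples_iff_of_linear {j : Fin r} {T : Set (Fin n)}
    (hT : colonIdeal u j = Ideal.span (var K '' T)) {ν : Finset (Fin n)} (hν : u j ⊆ ν) :
    ν ∈ multiples (u '' Set.Iio j) ↔ ∃ k ∈ qset K u j, k ∈ ν ∧ k ∉ u j := by
  constructor
  · intro h
    have h1 : mono K (ν \ u j) ∈ colonIdeal (K := K) u j := by
      rw [colonIdeal, mem_colon_monoIdeal, mono_mul_mono_mem_monoIdeal,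
        Finset.sdiff_union_of_subset hν]
      exact fun _ => h
    rw [hT, span_var_eq_monoIdeal, mono_mem_monoIdeal] at h1
    obtain ⟨_, ⟨k, hk, rfl⟩, hkν⟩ := h1
    rw [Finset.singleton_subset_iff, Finset.mem_sdiff] at hkν
    refine ⟨k, ?_, hkν⟩
    rw [qset, Set.mem_ofPred_eq, hT]
    exact Ideal.subset_span ⟨k, hk, rfl⟩
  · rintro ⟨k, hk, hkν, hku⟩
    exact mem_multiples_of_subset (mem_qset.1 hk hku) (Finset.insert_subset hkν hν)

theorem monoIdeal_congr {A B : Set (Finset (Fin n))} (h : multiples A = multiples B) :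
    monoIdeal K A = monoIdeal K B := by
  ext x
  rw [mem_monoIdeal_iff, mem_monoIdeal_iff, h]

/-- Divisibility is well founded: a monomial of I with no proper divisor in I is itself a minimal
generator. -/
theorem monoIdeal_minGens {I : Ideal (ExtAlg K n)} (hI : IsMonomialIdeal I) :
    monoIdeal K (minGens I) = I := by
  obtain ⟨S, rfl⟩ := hI
  apply monoIdeal_congr
  ext ν
  constructor
  · rintro ⟨μ, hμ, hμν⟩
    exact mem_multiples_of_subset ((mono_mem_monoIdeal K).1 hμ.1) hμν
  · intro hν
    induction ν using Finset.strongInduction with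
    | H ν ih =>
      by_cases h : ∃ ρ, ρ ⊂ ν ∧ ρ ∈ multiples S
      · obtain ⟨ρ, hρν, hρ⟩ := h
        exact mem_multiples_of_subset (ih ρ hρν hρ) hρν.subset
      · push Not at h
        refine ⟨ν, ⟨(mono_mem_monoIdeal K).2 hν, fun ρ hρν hρ => ?_⟩, subset_rfl⟩
        exact h ρ hρν ((mono_mem_monoIdeal K).1 hρ)

theorem gradedBetti_monoIdeal_of_linear (hmono : Monotone fun j => (u j).card)
    (hlin : ∀ j, ∃ S : Set (Fin n), colonIdeal (K := K) u j = Ideal.span (var K '' S)) {m : ℕ}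
    (hm : m ≤ r) (i d : ℕ) :
    gradedBetti (monoIdeal K (u '' {l | l.val < m})) i d =
      ∑ l : Fin r with l.val < m, if d = i + (u l).card then
        (i + (qset K u l).ncard - 1).choose i else 0 := by
  classical
  induction m generalizing i d with
  | zero =>
    have : ∀ q ≤ d, idealDeg (monoIdeal K (u '' {l | l.val < 0})) q = ⊥ := by
      intro q _
      rw [eq_bot_iff]
      intro x _
      have hx := (mem_monoIdeal_iff K).1 x.2
      have h0 : multiples (u '' {l : Fin r | l.val < 0}) = ∅ := by simp [multiples]
      rw [h0, Set.image_empty, Submodule.span_empty] at hx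
      exact Subtype.ext hx
    rw [gradedBetti_eq_zero_of_idealDeg this]
    simp
  | succ m ih =>
    set j : Fin r := ⟨m, hm⟩ with hj
    have hm' : m ≤ r := by omega
    have hIio : {l : Fin r | l.val < m} = Set.Iio j := by
      ext l
      simp [hj, Fin.lt_def]
    have hsucc : u '' {l : Fin r | l.val < m + 1} = u '' {l | l.val < m} ∪ {u j} := by
      rw [← Set.image_singleton, ← Set.image_union]
      congr 1
      ext l
      simp only [hj, Set.mem_ofPred_eq, Set.mem_union, Set.mem_singleton_iff, Fin.ext_iff]
      omega
    have hfil : (Finset.univ.filter fun l : Fin r => l.val < m + 1) =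
        insert j (Finset.univ.filter fun l : Fin r => l.val < m) := by
      ext l
      simp only [hj, Finset.mem_filter_univ, Finset.mem_insert, Fin.ext_iff]
      omega
    obtain ⟨T, hT⟩ := hlin j
    set S := (qset K u j).toFinset with hS
    have huS : u j ⊆ S := fun k hk => by
      rw [hS, Set.mem_toFinset, mem_qset]
      exact fun h => absurd hk h
    have hdisj : ∀ ν, u j ⊆ ν →
        (ν ∈ multiples (u '' {l : Fin r | l.val < m}) ↔ ¬Disjoint ν (S \ u j)) := by
      intro ν hν
      rw [hIio, mem_multiples_iff_of_linear hT hν, Finset.not_disjoint_iff]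
      simp only [hS, Finset.mem_sdiff, Set.mem_toFinset]
      exact ⟨fun ⟨k, h1, h2, h3⟩ => ⟨k, h2, h1, h3⟩, fun ⟨k, h2, h1, h3⟩ => ⟨k, h1, h2, h3⟩⟩
    obtain ⟨E⟩ := nonempty_colonSES (K := K) _ huS hdisj
    have hcard : (S \ u j).card + (u j).card = S.card := Finset.card_sdiff_add_card_eq_card huS
    -- The quotient contributes to Tor_{i+1} only if d = i + 1 + |u_j|, whereas Tor_i of the earlier
    -- ideal needs d = i + |u_l| with |u_l| ≤ |u_j|.
    have hadd := gradedBetti_add E (j := d) (fun i => by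
      by_cases hd : d = i + 1 + (u j).card
      · left
        rw [ih hm']
        refine Finset.sum_eq_zero fun l hl => if_neg ?_
        rw [Finset.mem_filter_univ] at hl
        have : (u l).card ≤ (u j).card := hmono (Fin.le_def.2 hl.le)
        omega
      · right
        rw [gradedBetti_monoIdeal_singleton, if_neg (by omega)]) i
    have hncard : (qset K u j).ncard = S.card := Set.ncard_eq_toFinset_card' _
    rw [hsucc, hadd, ih hm', gradedBetti_monoIdeal_singleton, hfil,
      Finset.sum_insert (by simp [hj]), add_comm, hncard]
    congr 1
    -- The shift |S \ u_j| turns the degree i + |S| of (e_S) into i + |u_j|.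
    exact if_congr (by omega) rfl rfl

theorem gradedBetti_of_hasLinearQuotients {I : Ideal (ExtAlg K n)} (hI : IsMonomialIdeal I)
    (hu : HasLinearQuotients I u) (i d : ℕ) :
    gradedBetti I i d = ∑ l : Fin r, if d = i + (u l).card then
      (i + (qset K u l).ncard - 1).choose i else 0 := by
  have h := gradedBetti_monoIdeal_of_linear hu.degree_mono hu.linear le_rfl i d
  have h1 : {l : Fin r | l.val < r} = Set.univ := Set.eq_univ_of_forall fun l => l.2
  have h2 : (Finset.univ.filter fun l : Fin r => l.val < r) = Finset.univ :=
    Finset.filter_true_of_mem fun l _ => l.2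
  rwa [h1, h2, Set.image_univ, hu.range_eq, monoIdeal_minGens hI] at h

theorem coeff_natCast_mul_tVar_pow_mul_sVar_pow (m : Fin 2 →₀ ℕ) (N a b : ℕ) :
    MvPowerSeries.coeff m ((N : MvPowerSeries (Fin 2) ℤ) * tVar ^ a * sVar ^ b) =
      if m 1 = a ∧ m 0 = b then (N : ℤ) else 0 := by
  classical
  rw [tVar, sVar, ← map_natCast (MvPowerSeries.C (σ := Fin 2) (R := ℤ)),
    MvPowerSeries.X_pow_eq, MvPowerSeries.X_pow_eq, mul_assoc,
    MvPowerSeries.monomial_mul_monomial, MvPowerSeries.coeff_C_mul, MvPowerSeries.coeff_monomial]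
  have : m = Finsupp.single 1 a + Finsupp.single 0 b ↔ m 1 = a ∧ m 0 = b := by
    constructor
    · rintro rfl
      simp
    · rintro ⟨rfl, rfl⟩
      ext k
      fin_cases k <;> simp
  simp [this]

end LinearQuotientSteps

end ExtLinQuot

end

/-! ### Comparison of coefficients. -/

theorem corollary3p5 {K : Type*} [Field K] (n : ℕ) (I : Ideal (ExtLinQuot.ExtAlg K n))
    (hI : ExtLinQuot.IsMonomialIdeal I) (r : ℕ) (u : Fin r → Finset (Fin n))
    (hu : ExtLinQuot.HasLinearQuotients I u) :
    HasSum
      (fun p : ℕ × ℕ => ∑ k : Fin r with (u k).card = p.2,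
        (((p.1 + (ExtLinQuot.qset K u k).ncard - 1).choose p.1 : ℕ) : MvPowerSeries (Fin 2) ℤ) *
          ExtLinQuot.tVar ^ p.1 * ExtLinQuot.sVar ^ (p.1 + p.2))
      (ExtLinQuot.poincareSeries I) := by
  rw [MvPowerSeries.WithPiTopology.hasSum_iff_hasSum_coeff]
  intro m
  have hc : MvPowerSeries.coeff m (ExtLinQuot.poincareSeries I) =
      (ExtLinQuot.gradedBetti I (m 1) (m 0) : ℤ) := rfl
  simp only [map_sum, ExtLinQuot.coeff_natCast_mul_tVar_pow_mul_sVar_pow]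
  rw [hc, ExtLinQuot.gradedBetti_of_hasLinearQuotients hI hu]
  -- The exponent of t fixes i and that of s fixes i + j, so one index pair matters. If m 0 < m 1,
  -- the truncated difference is harmless: the exponent of s then differs from m 0 and the term is
  -- zero.
  convert hasSum_single (m 1, m 0 - m 1) ?_ using 1
  · rw [Finset.sum_filter]
    push_cast
    refine Finset.sum_congr rfl fun l _ => ?_
    by_cases h : m 0 = m 1 + (u l).card
    · rw [if_pos h, if_pos (by omega), if_pos ⟨rfl, by omega⟩]
    · rw [if_neg h]
      split_ifs <;> omega
  · rintro ⟨a, b⟩ hab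
    refine Finset.sum_eq_zero fun l _ => if_neg ?_
    rintro ⟨h1, h2⟩
    exact hab (Prod.ext h1.symm (by simp only at h1 h2 ⊢; omega))
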